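/- Let $n>1$ and let $H_1,\dots,H_n$ be separable complex Hilbert spaces, each of dimension $>1$ (dimension meaning the cardinality of an orthonormal basis). Let $H=H_1\otimes\cdots\otimes H_n$ be their Hilbert space tensor product. For a subset $S\subseteq\{1,\dots,n\}$ put $H_S=\bigotimes_{i\in S}H_i$, so that $H=H_S\otimes H_{S'}$ with $S'$ the complement of $S$, and let $\mathcal A_S=\{A\otimes I : A \text{ a bounded operator on } H_S\}$ be the corresponding algebra of operators on $H$. Given a unit vector $v\in H$ and nonempty disjoint $S,T\subseteq\{1,\dots,n\}$, say that $\mathcal A_S$ is maximally correlated with $\mathcal A_T$ in the state $v$ if for every nonzero (orthogonal) projection $P'\in\mathcal A_S$ and every $\varepsilon>0$ there is a nonzero projection $P\in\mathcal A_T$ with $\langle v,Pv\rangle>0$ and $$\mathrm{Prob}_v(P'=1\,/\,P=1)=\frac{\langle v,P'Pv\rangle}{\langle v,Pv\rangle}>1-\varepsilon .$$ A unit vector $v\in H$ is called hyperentangled if for any two nonempty disjoint $S,T\subseteq\{1,\dots,n\}$ the algebra $\mathcal A_S$ is maximally correlated with $\mathcal A_T$ in the state $v$. Then the following three conditions are equivalent: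 1. There exists a hyperentangled state in $H$. 2. All the factors $H_1,\dots,H_n$ have the same dimension, and if $n>2$ their common dimension is infinite. 3. The set of hyperentangled states is norm dense in the unit sphere of $H$. -/

import Mathlib

open scoped TensorProduct ComplexOrder InnerProductSpace

set_option linter.unusedSectionVars false

noncomputable section

namespace HilbertTensor

universe u v

section Tensor

variable {ι : Type v} [Fintype ι] (H : ι → Type u)
  [∀ i, NormedAddCommGroup (H i)] [∀ i, InnerProductSpace ℂ (H i)]

/-! ### The Hilbert space tensor product of a finite family -/

/-- The algebraic tensor product of the family `H`; it will carry the inner product determined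
by `⟪⨂ x i, ⨂ y i⟫ = ∏ ⟪x i, y i⟫`. (A type of its own, because Mathlib puts a different norm, the
projective one, on `⨂[ℂ] i, H i`.) -/
def AlgTensor : Type (max u v) := ⨂[ℂ] i, H i

instance : AddCommGroup (AlgTensor H) := inferInstanceAs (AddCommGroup (⨂[ℂ] i, H i))
instance : Module ℂ (AlgTensor H) := inferInstanceAs (Module ℂ (⨂[ℂ] i, H i))

variable {H}

/-- The product vector `⨂ x i` in the algebraic tensor product. -/
def algTprod : MultilinearMap ℂ H (AlgTensor H) := PiTensorProduct.tprod ℂ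

theorem algTensor_induction {motive : AlgTensor H → Prop} (z : AlgTensor H)
    (smul_tprod : ∀ (r : ℂ) (x : Π i, H i), motive (r • algTprod x))
    (add : ∀ s t, motive s → motive t → motive (s + t)) : motive z :=
  PiTensorProduct.induction_on z smul_tprod add

/-- The linear map on the algebraic tensor product induced by a multilinear map. -/
def algLift {E : Type*} [AddCommGroup E] [Module ℂ E] (f : MultilinearMap ℂ H E) :
    AlgTensor H →ₗ[ℂ] E := PiTensorProduct.lift f

theorem algLift_tprod {E : Type*} [AddCommGroup E] [Module ℂ E] (f : MultilinearMap ℂ H E)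
    (x : Π i, H i) : algLift f (algTprod x) = f x := PiTensorProduct.lift.tprod x

/-- The linear functional `⨂ y i ↦ ∏ ⟪x i, y i⟫` on the algebraic tensor product. -/
def pairWith (x : Π i, H i) : AlgTensor H →ₗ[ℂ] ℂ :=
  algLift ((MultilinearMap.mkPiAlgebra ℂ ι ℂ).compLinearMap fun i => innerₛₗ ℂ (x i))

theorem pairWith_tprod (x y : Π i, H i) :
    pairWith x (algTprod y) = ∏ i, ⟪x i, y i⟫_ℂ := by
  simp [pairWith, algLift_tprod]

/-- The conjugate-linear functional `t ↦ conj (pairWith y t)`, as a multilinear function of `y`. -/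
def conjPair : MultilinearMap ℂ H (AlgTensor H →ₛₗ[starRingEnd ℂ] ℂ) where
  toFun y :=
    { toFun := fun t => starRingEnd ℂ (pairWith y t)
      map_add' := fun s t => by simp
      map_smul' := fun c t => by simp }
  map_update_add' := by
    classical
    intro _ m i a b
    ext t
    induction t using algTensor_induction with
    | smul_tprod r x =>
      have h : ∀ c : H i, ∏ j, ⟪Function.update m i c j, x j⟫_ℂ
          = ⟪c, x i⟫_ℂ * ∏ j ∈ Finset.univ.erase i, ⟪m j, x j⟫_ℂ := by
        intro c
        rw [← Finset.mul_prod_erase _ _ (Finset.mem_univ i)]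
        simp only [Function.update_self]
        congr 1
        refine Finset.prod_congr rfl fun j hj => ?_
        rw [Function.update_of_ne (Finset.ne_of_mem_erase hj)]
      simp only [LinearMap.coe_mk, AddHom.coe_mk, LinearMap.add_apply, map_smul, pairWith_tprod,
        smul_eq_mul, map_mul, h, inner_add_left]
      simp [add_mul, mul_add]
    | add s t hs ht =>
      rw [map_add, map_add, hs, ht]
  map_update_smul' := by
    classical
    intro _ m i c a
    ext t
    induction t using algTensor_induction with
    | smul_tprod r x =>
      have h : ∀ c : H i, ∏ j, ⟪Function.update m i c j, x j⟫_ℂ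
          = ⟪c, x i⟫_ℂ * ∏ j ∈ Finset.univ.erase i, ⟪m j, x j⟫_ℂ := by
        intro c
        rw [← Finset.mul_prod_erase _ _ (Finset.mem_univ i)]
        simp only [Function.update_self]
        congr 1
        refine Finset.prod_congr rfl fun j hj => ?_
        rw [Function.update_of_ne (Finset.ne_of_mem_erase hj)]
      simp only [LinearMap.coe_mk, AddHom.coe_mk, LinearMap.smul_apply, map_smul, pairWith_tprod,
        smul_eq_mul, map_mul, h, inner_smul_left]
      simp only [starRingEnd_self_apply]
      ring
    | add s t hs ht =>
      rw [map_add, map_add, hs, ht]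

instance : Inner ℂ (AlgTensor H) := ⟨fun s t => algLift conjPair t s⟩

theorem inner_tprod_left (x : Π i, H i) (t : AlgTensor H) :
    ⟪algTprod x, t⟫_ℂ = pairWith x t := by
  change algLift conjPair t (algTprod x) = _
  induction t using algTensor_induction with
  | smul_tprod r y =>
    rw [map_smul, map_smul, algLift_tprod, pairWith_tprod]
    change r • starRingEnd ℂ (pairWith y (algTprod x)) = _
    rw [pairWith_tprod, map_prod]
    simp
  | add s t hs ht => rw [map_add, map_add, LinearMap.add_apply, hs, ht]

theorem inner_tprod_tprod (x y : Π i, H i) :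
    ⟪(algTprod x : AlgTensor H), algTprod y⟫_ℂ = ∏ i, ⟪x i, y i⟫_ℂ := by
  rw [inner_tprod_left, pairWith_tprod]

theorem inner_add_left' (s s' t : AlgTensor H) : ⟪s + s', t⟫_ℂ = ⟪s, t⟫_ℂ + ⟪s', t⟫_ℂ :=
  map_add (algLift conjPair t) s s'

theorem inner_smul_left' (s t : AlgTensor H) (r : ℂ) :
    ⟪r • s, t⟫_ℂ = starRingEnd ℂ r * ⟪s, t⟫_ℂ :=
  LinearMap.map_smulₛₗ (algLift conjPair t) r s

theorem inner_add_right' (s t t' : AlgTensor H) : ⟪s, t + t'⟫_ℂ = ⟪s, t⟫_ℂ + ⟪s, t'⟫_ℂ := by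
  change algLift conjPair (t + t') s = _
  rw [map_add]; rfl

theorem inner_smul_right' (s t : AlgTensor H) (r : ℂ) : ⟪s, r • t⟫_ℂ = r * ⟪s, t⟫_ℂ := by
  change algLift conjPair (r • t) s = _
  rw [map_smul]; rfl

theorem inner_conj_symm' (s t : AlgTensor H) : starRingEnd ℂ ⟪t, s⟫_ℂ = ⟪s, t⟫_ℂ := by
  induction s using algTensor_induction with
  | smul_tprod r x =>
    induction t using algTensor_induction with
    | smul_tprod q y =>
      simp only [inner_smul_left', inner_smul_right', inner_tprod_tprod, map_mul, map_prod,
        starRingEnd_self_apply, inner_conj_symm]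
      ring
    | add t t' ht ht' => rw [inner_add_left', inner_add_right', map_add, ht, ht']
  | add s s' hs hs' => rw [inner_add_left', inner_add_right', map_add, hs, hs']

theorem posSemidef_prod {X : Type} [Fintype X] (s : Finset ι) (x : X → Π i, H i) :
    (Matrix.of fun k l : X => ∏ i ∈ s, ⟪x k i, x l i⟫_ℂ).PosSemidef := by
  classical
  induction s using Finset.induction_on with
  | empty =>
    have h := Matrix.posSemidef_gram ℂ (fun _ : X => (1 : ℂ))
    have e : (Matrix.of fun k l : X => ∏ i ∈ (∅ : Finset ι), ⟪x k i, x l i⟫_ℂ)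
        = Matrix.gram ℂ (fun _ : X => (1 : ℂ)) := by
      ext k l
      simp [Matrix.gram_apply]
    rw [e]
    exact h
  | insert a s ha ih =>
    have h := (Matrix.posSemidef_gram ℂ (fun k : X => x k a)).hadamard ih
    have e : (Matrix.of fun k l : X => ∏ i ∈ insert a s, ⟪x k i, x l i⟫_ℂ)
        = Matrix.hadamard (Matrix.gram ℂ (fun k : X => x k a))
          (Matrix.of fun k l : X => ∏ i ∈ s, ⟪x k i, x l i⟫_ℂ) := by
      ext k l
      simp [Matrix.gram_apply, Finset.prod_insert ha]
    rw [e]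
    exact h

theorem span_algTprod : Submodule.span ℂ (Set.range (algTprod (H := H))) = ⊤ :=
  PiTensorProduct.span_tprod_eq_top

theorem re_inner_self_nonneg' (t : AlgTensor H) : 0 ≤ RCLike.re ⟪t, t⟫_ℂ := by
  have ht : t ∈ Submodule.span ℂ (Set.range (algTprod (H := H))) := by
    rw [span_algTprod]; exact Submodule.mem_top
  obtain ⟨N, c, g, rfl⟩ := Submodule.mem_span_set'.1 ht
  choose x hx using fun k => (g k).2
  simp only [← hx]
  have hr : ∀ (s : AlgTensor H), ⟪s, ∑ k, c k • algTprod (x k)⟫_ℂ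
      = ∑ k, c k * ⟪s, algTprod (x k)⟫_ℂ := by
    intro s
    change algLift conjPair (∑ k, c k • algTprod (x k)) s = _
    rw [map_sum, LinearMap.sum_apply]
    exact Finset.sum_congr rfl fun k _ => inner_smul_right' s (algTprod (x k)) (c k)
  have hl : ∀ (s : AlgTensor H), ⟪∑ k, c k • algTprod (x k), s⟫_ℂ
      = ∑ k, star (c k) * ⟪algTprod (x k), s⟫_ℂ := by
    intro s
    change algLift conjPair s (∑ k, c k • algTprod (x k)) = _
    rw [map_sum]
    exact Finset.sum_congr rfl fun k _ => inner_smul_left' (algTprod (x k)) s (c k)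
  have h := (posSemidef_prod Finset.univ x).dotProduct_mulVec_nonneg c
  have e : ⟪∑ k, c k • (algTprod (x k) : AlgTensor H), ∑ k, c k • (algTprod (x k) : AlgTensor H)⟫_ℂ
      = dotProduct (star c)
        ((Matrix.of fun k l : Fin N => ∏ i, ⟪x k i, x l i⟫_ℂ).mulVec c) := by
    rw [hl]
    refine Finset.sum_congr rfl fun k _ => ?_
    rw [hr]
    simp only [Matrix.mulVec, dotProduct, inner_tprod_tprod, Matrix.of_apply, Pi.star_apply]
    congr 1
    exact Finset.sum_congr rfl fun l _ => mul_comm _ _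
  rw [e]
  exact (Complex.le_def.1 h).1

instance : PreInnerProductSpace.Core ℂ (AlgTensor H) where
  conj_inner_symm := inner_conj_symm'
  re_inner_nonneg := re_inner_self_nonneg'
  add_left := inner_add_left'
  smul_left := inner_smul_left'

instance : SeminormedAddCommGroup (AlgTensor H) :=
  InnerProductSpace.Core.toSeminormedAddCommGroup (𝕜 := ℂ)

instance : InnerProductSpace ℂ (AlgTensor H) := InnerProductSpace.ofCore inferInstance

variable (H) in
/-- The Hilbert space `⨂ H i`: the completion of the algebraic tensor product. -/
def HTensor : Type (max u v) := UniformSpace.Completion (AlgTensor H)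

instance : NormedAddCommGroup (HTensor H) :=
  inferInstanceAs (NormedAddCommGroup (UniformSpace.Completion (AlgTensor H)))
instance : InnerProductSpace ℂ (HTensor H) :=
  inferInstanceAs (InnerProductSpace ℂ (UniformSpace.Completion (AlgTensor H)))
instance : CompleteSpace (HTensor H) :=
  inferInstanceAs (CompleteSpace (UniformSpace.Completion (AlgTensor H)))

/-- The canonical isometry from the algebraic tensor product to its completion. -/
def toHTensor : AlgTensor H →ₗᵢ[ℂ] HTensor H :=
  (UniformSpace.Completion.toComplₗᵢ : AlgTensor H →ₗᵢ[ℂ] UniformSpace.Completion (AlgTensor H))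

theorem denseRange_toHTensor : DenseRange (toHTensor : AlgTensor H → HTensor H) :=
  UniformSpace.Completion.denseRange_coe

/-- The continuous extension of an isometry to the completion. -/
def extendIsometry {K : Type*} [NormedAddCommGroup K] [InnerProductSpace ℂ K] [CompleteSpace K]
    (f : AlgTensor H →ₗᵢ[ℂ] K) : HTensor H →L[ℂ] K :=
  f.toContinuousLinearMap.extend toHTensor.toContinuousLinearMap

theorem extendIsometry_toHTensor {K : Type*} [NormedAddCommGroup K] [InnerProductSpace ℂ K]
    [CompleteSpace K] (f : AlgTensor H →ₗᵢ[ℂ] K) (t : AlgTensor H) :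
    extendIsometry f (toHTensor t) = f t :=
  ContinuousLinearMap.extend_eq (e := toHTensor.toContinuousLinearMap) f.toContinuousLinearMap
    denseRange_toHTensor toHTensor.isometry.isUniformInducing t

/-- The product vector `⨂ x i` in the Hilbert space `⨂ H i`, a multilinear function of `x`. -/
def htprod : MultilinearMap ℂ H (HTensor H) :=
  toHTensor.toLinearMap.compMultilinearMap algTprod

theorem htprod_eq (x : Π i, H i) : htprod x = toHTensor (algTprod x) := rfl

theorem inner_htprod (x y : Π i, H i) : ⟪htprod x, htprod y⟫_ℂ = ∏ i, ⟪x i, y i⟫_ℂ := by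
  rw [htprod_eq, htprod_eq, LinearIsometry.inner_map_map]
  exact inner_tprod_tprod x y

end Tensor

/-! ### The Hilbert space tensor product of two spaces -/

section Two

variable (E : Type u) (F : Type v) [NormedAddCommGroup E] [InnerProductSpace ℂ E]
  [NormedAddCommGroup F] [InnerProductSpace ℂ F]

/-- The Hilbert space tensor product of two spaces: the completion of the algebraic tensor product
for the inner product determined by `⟪a ⊗ b, c ⊗ d⟫ = ⟪a, c⟫ * ⟪b, d⟫`. -/
def HTensor₂ : Type (max u v) := UniformSpace.Completion (E ⊗[ℂ] F)

instance : NormedAddCommGroup (HTensor₂ E F) :=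
  inferInstanceAs (NormedAddCommGroup (UniformSpace.Completion (E ⊗[ℂ] F)))
instance : InnerProductSpace ℂ (HTensor₂ E F) :=
  inferInstanceAs (InnerProductSpace ℂ (UniformSpace.Completion (E ⊗[ℂ] F)))
instance : CompleteSpace (HTensor₂ E F) :=
  inferInstanceAs (CompleteSpace (UniformSpace.Completion (E ⊗[ℂ] F)))

/-- The bilinear map `(a, b) ↦ a ⊗ b` into the Hilbert space tensor product. -/
def tmul₂ : E →ₗ[ℂ] F →ₗ[ℂ] HTensor₂ E F :=
  (TensorProduct.mk ℂ E F).compr₂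
    (UniformSpace.Completion.toComplₗᵢ : (E ⊗[ℂ] F) →ₗᵢ[ℂ] UniformSpace.Completion _).toLinearMap

variable {E F}

theorem inner_tmul₂ (a c : E) (b d : F) :
    ⟪tmul₂ E F a b, tmul₂ E F c d⟫_ℂ = ⟪a, c⟫_ℂ * ⟪b, d⟫_ℂ :=
  (UniformSpace.Completion.inner_coe (𝕜 := ℂ) (a ⊗ₜ[ℂ] b) (c ⊗ₜ[ℂ] d)).trans
    (TensorProduct.inner_tmul ℂ a c b d)

variable (F) in
/-- The operator `A ⊗ I` on `E ⊗ F`. -/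
def tensorId (A : E →L[ℂ] E) : HTensor₂ E F →L[ℂ] HTensor₂ E F :=
  ((TensorProduct.mapL A (ContinuousLinearMap.id ℂ F)).completion :
    UniformSpace.Completion (E ⊗[ℂ] F) →L[ℂ] UniformSpace.Completion (E ⊗[ℂ] F))

theorem tensorId_tmul₂ (A : E →L[ℂ] E) (a : E) (b : F) :
    tensorId F A (tmul₂ E F a b) = tmul₂ E F (A a) b :=
  ContinuousLinearMap.completion_apply_coe
    (TensorProduct.mapL A (ContinuousLinearMap.id ℂ F)) (a ⊗ₜ[ℂ] b)

end Two

/-! ### Subsystems and the operators `A ⊗ I` -/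

section Subsystem

variable {ι : Type v} [Fintype ι] [dec : DecidableEq ι] (H : ι → Type u)
  [∀ i, NormedAddCommGroup (H i)] [∀ i, InnerProductSpace ℂ (H i)]

/-- The state space `⨂_{i ∈ S} H i` of the subsystem `S`. -/
abbrev SubTensor (S : Finset ι) : Type (max u v) := HTensor fun i : S => H i

variable {H}

/-- Restriction of a family of vectors to the indices in `S`. -/
def restr (S : Finset ι) (x : Π i, H i) : Π i : S, H i := fun i => x i

theorem restr_update_mem {S : Finset ι} {i : ι} (hi : i ∈ S) (m : Π i, H i) (a : H i) :
    restr S (Function.update m i a) = Function.update (restr S m) ⟨i, hi⟩ a := by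
  funext j
  rcases eq_or_ne j ⟨i, hi⟩ with rfl | hj
  · simp [restr]
  · have hj' : (j : ι) ≠ i := fun h => hj (Subtype.ext h)
    simp [restr, hj, hj']

theorem restr_update_notMem {S : Finset ι} {i : ι} (hi : i ∉ S) (m : Π i, H i) (a : H i) :
    restr S (Function.update m i a) = restr S m := by
  funext j
  have hj' : (j : ι) ≠ i := fun h => hi (h ▸ j.2)
  simp [restr, hj']

/-- The multilinear map `x ↦ (⨂_{i ∈ S} x i) ⊗ (⨂_{i ∉ S} x i)`. -/
def splitMultilinear (S : Finset ι) :
    MultilinearMap ℂ H (HTensor₂ (SubTensor H S) (SubTensor H Sᶜ)) where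
  toFun x := tmul₂ _ _ (htprod (restr S x)) (htprod (restr Sᶜ x))
  map_update_add' := by
    intro inst m i a b
    obtain rfl : inst = dec := Subsingleton.elim _ _
    by_cases hi : i ∈ S
    · have hi' : i ∉ Sᶜ := by simpa using hi
      simp only [restr_update_mem hi, restr_update_notMem hi', MultilinearMap.map_update_add,
        map_add, LinearMap.add_apply]
    · have hi' : i ∈ Sᶜ := by simpa using hi
      simp only [restr_update_mem hi', restr_update_notMem hi, MultilinearMap.map_update_add,
        map_add]
  map_update_smul' := by
    intro inst m i c a
    obtain rfl : inst = dec := Subsingleton.elim _ _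
    by_cases hi : i ∈ S
    · have hi' : i ∉ Sᶜ := by simpa using hi
      simp only [restr_update_mem hi, restr_update_notMem hi', MultilinearMap.map_update_smul,
        map_smul, LinearMap.smul_apply]
    · have hi' : i ∈ Sᶜ := by simpa using hi
      simp only [restr_update_mem hi', restr_update_notMem hi, MultilinearMap.map_update_smul,
        map_smul]

/-- The regrouping map on the algebraic tensor product. -/
def algSplit (S : Finset ι) : AlgTensor H →ₗ[ℂ] HTensor₂ (SubTensor H S) (SubTensor H Sᶜ) :=
  algLift (splitMultilinear S)

theorem algSplit_tprod (S : Finset ι) (x : Π i, H i) :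
    algSplit S (algTprod x) = tmul₂ _ _ (htprod (restr S x)) (htprod (restr Sᶜ x)) :=
  algLift_tprod _ x

theorem inner_algSplit (S : Finset ι) (s t : AlgTensor H) :
    ⟪algSplit S s, algSplit S t⟫_ℂ = ⟪s, t⟫_ℂ := by
  induction s using algTensor_induction with
  | smul_tprod r x =>
    induction t using algTensor_induction with
    | smul_tprod q y =>
      rw [map_smul, map_smul, inner_smul_left, inner_smul_right, inner_smul_left, inner_smul_right,
        algSplit_tprod, algSplit_tprod, inner_tmul₂, inner_htprod, inner_htprod, inner_tprod_tprod]
      congr 2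
      exact (congrArg₂ (· * ·) (Finset.prod_coe_sort S fun i => ⟪x i, y i⟫_ℂ)
        (Finset.prod_coe_sort Sᶜ fun i => ⟪x i, y i⟫_ℂ)).trans (Finset.prod_mul_prod_compl S _)
    | add t t' ht ht' => rw [map_add, inner_add_right, inner_add_right, ht, ht']
  | add s s' hs hs' => rw [map_add, inner_add_left, inner_add_left, hs, hs']

/-- The canonical unitary `⨂ H i → (⨂_{i ∈ S} H i) ⊗ (⨂_{i ∉ S} H i)`, which sends `⨂ x i` to
`(⨂_{i ∈ S} x i) ⊗ (⨂_{i ∉ S} x i)`: the continuous extension of the (isometric) regrouping map. -/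
def split (S : Finset ι) : HTensor H →L[ℂ] HTensor₂ (SubTensor H S) (SubTensor H Sᶜ) :=
  extendIsometry ((algSplit S).isometryOfInner (inner_algSplit S))

theorem split_htprod (S : Finset ι) (x : Π i, H i) :
    split S (htprod x) = tmul₂ _ _ (htprod (restr S x)) (htprod (restr Sᶜ x)) :=
  (extendIsometry_toHTensor _ _).trans (algSplit_tprod S x)

/-- The operator `A ⊗ I` on `⨂ H i = (⨂_{i ∈ S} H i) ⊗ (⨂_{i ∉ S} H i)`, for a bounded operator `A`
on `⨂_{i ∈ S} H i`: the operator `A ⊗ I` on the right-hand side, conjugated with the canonical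
unitary. -/
def ampliate (S : Finset ι) (A : SubTensor H S →L[ℂ] SubTensor H S) : HTensor H →L[ℂ] HTensor H :=
  ContinuousLinearMap.adjoint (split S) ∘L tensorId (SubTensor H Sᶜ) A ∘L split S

/-- The matrix elements of `A ⊗ I` between product vectors. -/
theorem inner_ampliate (S : Finset ι) (A : SubTensor H S →L[ℂ] SubTensor H S) (x y : Π i, H i) :
    ⟪htprod y, ampliate S A (htprod x)⟫_ℂ
      = ⟪htprod (restr S y), A (htprod (restr S x))⟫_ℂ * ∏ i ∈ Sᶜ, ⟪y i, x i⟫_ℂ := by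
  rw [ampliate, ContinuousLinearMap.comp_apply, ContinuousLinearMap.adjoint_inner_right,
    ContinuousLinearMap.comp_apply, split_htprod, split_htprod, tensorId_tmul₂, inner_tmul₂,
    inner_htprod]
  congr 1
  exact Finset.prod_coe_sort Sᶜ fun i => ⟪y i, x i⟫_ℂ

variable (H) in
/-- The operator algebra of the subsystem `S`: all the operators `A ⊗ I` on `⨂ H i`, where `A` is a
bounded operator on `⨂_{i ∈ S} H i`. -/
def localAlgebra (S : Finset ι) : Set (HTensor H →L[ℂ] HTensor H) :=
  Set.range (ampliate S)

end Subsystem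

/-! ### Maximal correlation and hyperentanglement -/

section Correlation

variable {K : Type u} [NormedAddCommGroup K] [InnerProductSpace ℂ K] [CompleteSpace K]

/-- The probability of the outcome `1` for the projection `P` in the state `v`. -/
def prob (v : K) (P : K →L[ℂ] K) : ℝ := RCLike.re ⟪v, P v⟫_ℂ

/-- The conditional probability `Prob_v(P' = 1 / P = 1)` of commuting projections `P'` and `P`. -/
def condProb (v : K) (P' P : K →L[ℂ] K) : ℝ := prob v (P' ∘L P) / prob v P

/-- The algebra `𝒜'` is maximally correlated with the algebra `𝒜` in the state `v`: whatever the
nonzero projection `P'` in `𝒜'`, some nonzero projection `P` in `𝒜` (that occurs with positive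
probability) makes `P' = 1` as probable as one likes. -/
def MaximallyCorrelated (𝒜' 𝒜 : Set (K →L[ℂ] K)) (v : K) : Prop :=
  ∀ P' ∈ 𝒜', IsStarProjection P' → P' ≠ 0 → ∀ ε : ℝ, 0 < ε →
    ∃ P ∈ 𝒜, IsStarProjection P ∧ P ≠ 0 ∧ 0 < prob v P ∧ 1 - ε < condProb v P' P

variable {ι : Type v} [Fintype ι] [DecidableEq ι] (H : ι → Type u)
  [∀ i, NormedAddCommGroup (H i)] [∀ i, InnerProductSpace ℂ (H i)]

/-- The hyperentangled states: the unit vectors `v` of `⨂ H i` such that, for any two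
nonoverlapping (nonempty) subsystems `S` and `T`, the algebra of `S` is maximally correlated with
the algebra of `T` in the state `v`. -/
def hyperentangledStates : Set (HTensor H) :=
  {v | ‖v‖ = 1 ∧ ∀ S T : Finset ι, S.Nonempty → T.Nonempty → Disjoint S T →
    MaximallyCorrelated (localAlgebra H S) (localAlgebra H T) v}

/-- The dimension of a Hilbert space: the cardinality of an orthonormal basis (all orthonormal
bases of a Hilbert space have the same cardinality, so that the least one is the only one). -/
def hilbertDim (E : Type u) [NormedAddCommGroup E] [InnerProductSpace ℂ E] : Cardinal.{u} :=
  sInf {κ | ∃ w : Set E, Orthonormal ℂ ((↑) : w → E) ∧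
    (Submodule.span ℂ w).topologicalClosure = ⊤ ∧ Cardinal.mk w = κ}

end Correlation

end HilbertTensor

end

noncomputable section

namespace HilbertTensor

universe u v

/-! ### Extension from product vectors by density -/

section Total

variable {ι : Type v} [Fintype ι] {H : ι → Type u}
  [∀ i, NormedAddCommGroup (H i)] [∀ i, InnerProductSpace ℂ (H i)]

/-! For a subsystem T with complement T', a vector v of H_T ⊗ H_T' defines a conjugate-linear map e
↦ ⟨e|v from H_T to H_T'. To stay inside H, fix a unit vector e₀ of H_T and use the slice (|e₀⟩⟨e| ⊗
I) v, which lies in e₀ ⊗ H_T'. The proof compares how large the set of slices is with what maximal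
correlation needs.

Sufficiency (`DenseSlices.maximallyCorrelated`). Suppose that the slices are dense in e₀ ⊗ H_T'. A
nonzero projection P' of a disjoint subsystem commutes with the algebra of T, so its range contains
a nonzero vector e₀ ⊗ y. If the slice at f is close to this vector, then P, the projection onto the
line of f, makes P' = 1 almost certain.

Genericity (`sphere_subset_closure_hyperentangledStates`). Having a slice within δ of a given target
is an open condition on v. It is dense when every v either has unit vectors with arbitrarily small
slices or already attains the target: in the first case the component of v along such a unit vector
can be replaced, at small cost, by a small multiple of the target. Small slices exist by Bessel's
inequality if H_T is infinite-dimensional. If dim H_T' ≤ dim H_T < ∞, the slice map is either not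
injective or onto. Separability leaves countably many conditions, and Baire's theorem followed by
normalization gives density in the sphere.

Necessity (`card_le_finrank_of_maximallyCorrelated`). If H_T is finite-dimensional, k pairwise
orthogonal nonzero projections of S are almost certified by k vectors of H_T. Their slices are
almost orthogonal, so the vectors are linearly independent, and dim H_S ≤ dim H_T. Single factors on
both sides give equal dimensions. With three factors of common finite dimension d > 1, taking two
against one gives the contradiction d² ≤ d. -/

theorem eq_top_of_htprod_mem {M : Submodule ℂ (HTensor H)} (hM : IsClosed (M : Set (HTensor H)))
    (h : ∀ x, htprod x ∈ M) : M = ⊤ := by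
  rw [eq_top_iff]
  intro z _
  refine (denseRange_toHTensor (H := H)).induction_on (p := fun z => z ∈ M) z hM fun t => ?_
  induction t using algTensor_induction with
  | smul_tprod r x => rw [map_smul]; exact M.smul_mem r (h x)
  | add s t hs ht => rw [map_add]; exact M.add_mem hs ht

theorem ext_htprod {G : Type*} [AddCommGroup G] [Module ℂ G] [TopologicalSpace G] [T2Space G]
    {σ : ℂ →+* ℂ} {A B : HTensor H →SL[σ] G}
    (h : ∀ x, A (htprod x) = B (htprod x)) : A = B := by
  have := eq_top_of_htprod_mem (M := LinearMap.eqLocus A.toLinearMap B.toLinearMap)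
    (isClosed_eq A.continuous B.continuous) h
  ext z
  exact (this ▸ Submodule.mem_top : z ∈ LinearMap.eqLocus A.toLinearMap B.toLinearMap)

theorem norm_htprod (x : Π i, H i) : ‖htprod x‖ = ∏ i, ‖x i‖ := by
  have h : (‖htprod x‖ : ℂ) ^ 2 = (∏ i, ‖x i‖ : ℝ) ^ 2 := by
    have h' := inner_htprod x x
    simp only [inner_self_eq_norm_sq_to_K, Finset.prod_pow] at h'
    push_cast
    exact h'
  have h2 : ‖htprod x‖ ^ 2 = (∏ i, ‖x i‖ : ℝ) ^ 2 := by exact_mod_cast h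
  exact (pow_left_inj₀ (norm_nonneg _) (Finset.prod_nonneg fun i _ => norm_nonneg _)
    two_ne_zero).1 h2

theorem continuous_htprod : Continuous (htprod : (Π i, H i) → HTensor H) :=
  (MultilinearMap.mkContinuous (E := H) (G := HTensor H) htprod 1
    fun x => by rw [norm_htprod, one_mul]).cont

/-- The closed span of the continuous image of a separable space is separable. This is what makes
the family of conditions in the Baire argument countable. -/
instance [∀ i, TopologicalSpace.SeparableSpace (H i)] :
    TopologicalSpace.SeparableSpace (HTensor H) := by
  rw [← TopologicalSpace.isSeparable_univ_iff]
  have h := ((TopologicalSpace.isSeparable_range (continuous_htprod (H := H))).span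
    (R := ℂ)).closure
  have e := eq_top_of_htprod_mem
    (M := (Submodule.span ℂ (Set.range (htprod (H := H)))).topologicalClosure)
    (Submodule.isClosed_topologicalClosure _)
    fun x => Submodule.le_topologicalClosure _ (Submodule.subset_span ⟨x, rfl⟩)
  rw [← Submodule.topologicalClosure_coe, e] at h
  exact h

variable {E : Type u} {F : Type v} [NormedAddCommGroup E] [InnerProductSpace ℂ E]
  [NormedAddCommGroup F] [InnerProductSpace ℂ F]

theorem eq_top_of_tmul₂_mem {M : Submodule ℂ (HTensor₂ E F)}
    (hM : IsClosed (M : Set (HTensor₂ E F))) (h : ∀ a b, tmul₂ E F a b ∈ M) : M = ⊤ := by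
  rw [eq_top_iff]
  intro z _
  refine (UniformSpace.Completion.denseRange_coe (α := E ⊗[ℂ] F)).induction_on
    (p := fun z : HTensor₂ E F => z ∈ M) z hM fun t => ?_
  let ι : (E ⊗[ℂ] F) →ₗ[ℂ] HTensor₂ E F :=
    (UniformSpace.Completion.toComplₗᵢ : (E ⊗[ℂ] F) →ₗᵢ[ℂ] UniformSpace.Completion _).toLinearMap
  change ι t ∈ M
  induction t using TensorProduct.induction_on with
  | zero => rw [map_zero]; exact M.zero_mem
  | tmul a b => exact h a b
  | add s t hs ht => rw [map_add]; exact M.add_mem hs ht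

theorem ext_tmul₂ {G : Type*} [AddCommGroup G] [Module ℂ G] [TopologicalSpace G] [T2Space G]
    {σ : ℂ →+* ℂ} {A B : HTensor₂ E F →SL[σ] G}
    (h : ∀ a b, A (tmul₂ E F a b) = B (tmul₂ E F a b)) : A = B := by
  have := eq_top_of_tmul₂_mem (M := LinearMap.eqLocus A.toLinearMap B.toLinearMap)
    (isClosed_eq A.continuous B.continuous) h
  ext z
  exact (this ▸ Submodule.mem_top : z ∈ LinearMap.eqLocus A.toLinearMap B.toLinearMap)

theorem norm_tmul₂ (a : E) (b : F) : ‖tmul₂ E F a b‖ = ‖a‖ * ‖b‖ := by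
  have h : (‖tmul₂ E F a b‖ : ℂ) ^ 2 = (‖a‖ * ‖b‖ : ℝ) ^ 2 := by
    have h' := inner_tmul₂ a a b b
    simp only [inner_self_eq_norm_sq_to_K] at h'
    push_cast
    rw [mul_pow]
    exact h'
  have h2 : ‖tmul₂ E F a b‖ ^ 2 = (‖a‖ * ‖b‖) ^ 2 := by exact_mod_cast h
  exact (pow_left_inj₀ (norm_nonneg _) (by positivity) two_ne_zero).1 h2

/-- The bounded bilinear map `(a, b) ↦ a ⊗ b`. -/
def tmulL : E →L[ℂ] F →L[ℂ] HTensor₂ E F :=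
  LinearMap.mkContinuous₂ (tmul₂ E F) 1 fun a b => by rw [norm_tmul₂, one_mul]

theorem tmulL_apply (a : E) (b : F) : tmulL a b = tmul₂ E F a b := rfl

theorem tensorId_one : tensorId F (1 : E →L[ℂ] E) = 1 :=
  ext_tmul₂ fun a b => by rw [tensorId_tmul₂]; rfl

theorem tensorId_mul (A B : E →L[ℂ] E) :
    tensorId F (A * B) = tensorId F A * tensorId F B :=
  ext_tmul₂ fun a b => by
    rw [mul_apply_eq_comp, tensorId_tmul₂, tensorId_tmul₂, tensorId_tmul₂]; rfl

theorem tensorId_add (A B : E →L[ℂ] E) :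
    tensorId F (A + B) = tensorId F A + tensorId F B :=
  ext_tmul₂ fun a b => by
    rw [add_apply, tensorId_tmul₂, tensorId_tmul₂, tensorId_tmul₂,
      add_apply, map_add, LinearMap.add_apply]

theorem tensorId_smul (c : ℂ) (A : E →L[ℂ] E) : tensorId F (c • A) = c • tensorId F A :=
  ext_tmul₂ fun a b => by
    rw [smul_apply, tensorId_tmul₂, tensorId_tmul₂,
      smul_apply, map_smul, LinearMap.smul_apply]

theorem tensorId_adjoint [CompleteSpace E] (A : E →L[ℂ] E) :
    tensorId F (ContinuousLinearMap.adjoint A) = ContinuousLinearMap.adjoint (tensorId F A) := by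
  refine ext_tmul₂ fun a b => ?_
  -- Passing to the functionals ⟪·, z⟫ in z allows density of product vectors to be used in the
  -- second variable as well.
  have key : innerSL ℂ (tensorId F (ContinuousLinearMap.adjoint A) (tmul₂ E F a b))
      = innerSL ℂ (ContinuousLinearMap.adjoint (tensorId F A) (tmul₂ E F a b)) := by
    refine ext_tmul₂ fun c d => ?_
    rw [innerSL_apply_apply, innerSL_apply_apply, ContinuousLinearMap.adjoint_inner_left,
      tensorId_tmul₂, tensorId_tmul₂, inner_tmul₂, inner_tmul₂,
      ContinuousLinearMap.adjoint_inner_left]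
  exact ext_inner_right ℂ fun z => by simpa using DFunLike.congr_fun key z

end Total

/-! ### The unitary H ≅ H_S ⊗ H_S' and commutation of disjoint subsystems -/

section Split

variable {ι : Type v} [Fintype ι] [DecidableEq ι] {H : ι → Type u}
  [∀ i, NormedAddCommGroup (H i)] [∀ i, InnerProductSpace ℂ (H i)]

theorem inner_split (S : Finset ι) (y z : HTensor H) : ⟪split S y, split S z⟫_ℂ = ⟪y, z⟫_ℂ := by
  have h1 : ∀ x : Π i, H i, (innerSL ℂ (split S (htprod x))).comp (split S)
      = innerSL ℂ (htprod x) := fun x => ext_htprod fun w => by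
    simp only [ContinuousLinearMap.comp_apply, innerSL_apply_apply]
    exact (congrArg₂ _ (extendIsometry_toHTensor _ _) (extendIsometry_toHTensor _ _)).trans
      ((inner_algSplit S _ _).trans (LinearIsometry.inner_map_map toHTensor _ _).symm)
  have h2 : ContinuousLinearMap.adjoint (split S) ∘L split S = 1 := ext_htprod fun x => by
    refine ext_inner_right ℂ fun w => ?_
    rw [ContinuousLinearMap.comp_apply, ContinuousLinearMap.adjoint_inner_left]
    exact DFunLike.congr_fun (h1 x) w
  rw [← ContinuousLinearMap.adjoint_inner_right, ← ContinuousLinearMap.comp_apply, h2]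
  rfl

theorem adjoint_split_split (S : Finset ι) (z : HTensor H) :
    ContinuousLinearMap.adjoint (split S) (split S z) = z :=
  ext_inner_left ℂ fun y => by rw [ContinuousLinearMap.adjoint_inner_right, inner_split]

/-- Gluing of a family indexed by `S` and a family indexed by the complement of `S`. -/
def glue (S : Finset ι) (x : Π i : S, H i) (y : Π i : (Sᶜ : Finset ι), H i) : Π i, H i :=
  fun i => if h : i ∈ S then x ⟨i, h⟩ else y ⟨i, by simpa using h⟩

theorem restr_glue (S : Finset ι) (x : Π i : S, H i) (y : Π i : (Sᶜ : Finset ι), H i) :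
    restr S (glue S x y) = x := by
  funext i
  simp [restr, glue]

theorem restr_compl_glue (S : Finset ι) (x : Π i : S, H i) (y : Π i : (Sᶜ : Finset ι), H i) :
    restr Sᶜ (glue S x y) = y := by
  funext i
  have h : (i : ι) ∉ S := Finset.mem_compl.1 i.2
  simp [restr, glue, h]

/-- The range of an isometry on a complete space is closed, so it suffices to reach a ⊗ b, by
density in a and then in b. Surjectivity makes the regrouping map unitary, which is what makes A ↦ A
⊗ I multiplicative. -/
theorem range_split (S : Finset ι) : (split (H := H) S).range = ⊤ := by
  have hc : IsClosed ((split (H := H) S).range :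
      Set (HTensor₂ (SubTensor H S) (SubTensor H Sᶜ))) := by
    have hi : Isometry (split (H := H) S) :=
      ((split (H := H) S).toLinearMap.isometryOfInner (inner_split S)).isometry
    exact hi.isClosedEmbedding.isClosed_range
  have h1 : ∀ (a : SubTensor H S) (y : Π i : (Sᶜ : Finset ι), H i),
      tmul₂ _ _ a (htprod y) ∈ (split (H := H) S).range := by
    intro a y
    have := eq_top_of_htprod_mem
      (M := (split (H := H) S).range.comap (tmulL.flip (htprod y)).toLinearMap)
      (hc.preimage (tmulL.flip (htprod y)).continuous)
      fun x => ⟨htprod (glue S x y), by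
        change split S _ = _
        rw [split_htprod, restr_glue, restr_compl_glue]; rfl⟩
    exact (this ▸ Submodule.mem_top :
      a ∈ (split (H := H) S).range.comap (tmulL.flip (htprod y)).toLinearMap)
  refine eq_top_of_tmul₂_mem hc fun a b => ?_
  have := eq_top_of_htprod_mem
    (M := (split (H := H) S).range.comap (tmulL a).toLinearMap)
    (hc.preimage (tmulL a).continuous) fun y => h1 a y
  exact (this ▸ Submodule.mem_top : b ∈ (split (H := H) S).range.comap (tmulL a).toLinearMap)

theorem split_adjoint_split (S : Finset ι) (z : HTensor₂ (SubTensor H S) (SubTensor H Sᶜ)) :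
    split S (ContinuousLinearMap.adjoint (split S) z) = z := by
  obtain ⟨w, rfl⟩ : z ∈ (split (H := H) S).range := range_split (H := H) S ▸ Submodule.mem_top
  exact congrArg (split S) (adjoint_split_split S w)

theorem ampliate_apply (S : Finset ι) (A : SubTensor H S →L[ℂ] SubTensor H S) (z : HTensor H) :
    ampliate S A z
      = ContinuousLinearMap.adjoint (split S) (tensorId (SubTensor H Sᶜ) A (split S z)) := rfl

variable (H) in
/-- The unital star-homomorphism `A ↦ A ⊗ I`. -/
def ampliateHom (S : Finset ι) :
    (SubTensor H S →L[ℂ] SubTensor H S) →⋆ₐ[ℂ] (HTensor H →L[ℂ] HTensor H) where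
  toFun := ampliate S
  map_one' := by
    ext z
    rw [ampliate_apply, tensorId_one]
    exact adjoint_split_split S z
  map_mul' A B := by
    ext z
    rw [mul_apply_eq_comp, ampliate_apply, ampliate_apply, ampliate_apply,
      split_adjoint_split, tensorId_mul]
    rfl
  map_zero' := by
    ext z
    have h : tensorId (SubTensor H Sᶜ) (0 : SubTensor H S →L[ℂ] SubTensor H S) = 0 := by
      simpa using tensorId_smul (F := SubTensor H Sᶜ) 0 (0 : SubTensor H S →L[ℂ] SubTensor H S)
    rw [ampliate_apply, h]
    simp
  map_add' A B := by
    ext z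
    simp only [add_apply, ampliate_apply, tensorId_add, map_add]
  commutes' r := by
    ext z
    have h : tensorId (SubTensor H Sᶜ) (algebraMap ℂ (SubTensor H S →L[ℂ] SubTensor H S) r)
        = r • 1 := by
      rw [Algebra.algebraMap_eq_smul_one, tensorId_smul, tensorId_one]
    rw [ampliate_apply, h, Algebra.algebraMap_eq_smul_one]
    simp [adjoint_split_split]
  map_star' A := by
    rw [ContinuousLinearMap.star_eq_adjoint, ContinuousLinearMap.star_eq_adjoint, ampliate,
      tensorId_adjoint, ampliate, ContinuousLinearMap.adjoint_comp,
      ContinuousLinearMap.adjoint_comp, ContinuousLinearMap.adjoint_adjoint]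
    rfl

theorem ampliateHom_apply (S : Finset ι) (A : SubTensor H S →L[ℂ] SubTensor H S) :
    ampliateHom H S A = ampliate S A := rfl

theorem localAlgebra_eq_range (S : Finset ι) :
    localAlgebra H S = Set.range (ampliateHom H S) := rfl

/-- The vector `a ⊗ b`, regarded as a vector of `⨂ H i`. -/
def regroup (S : Finset ι) (a : SubTensor H S) (b : SubTensor H Sᶜ) : HTensor H :=
  ContinuousLinearMap.adjoint (split S) (tmulL a b)

theorem split_regroup (S : Finset ι) (a : SubTensor H S) (b : SubTensor H Sᶜ) :
    split S (regroup S a b) = tmul₂ _ _ a b := split_adjoint_split S _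

theorem ampliate_regroup (S : Finset ι) (A : SubTensor H S →L[ℂ] SubTensor H S)
    (a : SubTensor H S) (b : SubTensor H Sᶜ) :
    ampliate S A (regroup S a b) = regroup S (A a) b := by
  rw [ampliate_apply, split_regroup, tensorId_tmul₂]; rfl

theorem inner_regroup (S : Finset ι) (a c : SubTensor H S) (b d : SubTensor H Sᶜ) :
    ⟪regroup S a b, regroup S c d⟫_ℂ = ⟪a, c⟫_ℂ * ⟪b, d⟫_ℂ := by
  rw [← inner_split S, split_regroup, split_regroup, inner_tmul₂]

theorem regroup_htprod (S : Finset ι) (x : Π i, H i) :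
    regroup S (htprod (restr S x)) (htprod (restr Sᶜ x)) = htprod x := by
  rw [regroup, tmulL_apply, ← split_htprod, adjoint_split_split]

theorem eq_zero_of_inner_regroup {S : Finset ι} {z : HTensor H}
    (h : ∀ a b, ⟪regroup S a b, z⟫_ℂ = 0) : z = 0 := by
  have h0 : innerSL ℂ (split S z) = 0 := ext_tmul₂ fun a b => by
    rw [innerSL_apply_apply, ← split_regroup, inner_split, ← inner_conj_symm, h]
    simp
  have h1 : split S z = 0 := by
    have := DFunLike.congr_fun h0 (split S z)
    simpa using this
  rw [← adjoint_split_split S z, h1, map_zero]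

/-- For product p and q the inner product factors over S, T and the remaining indices; linearity and
continuity extend this to q and then to p. It computes matrix elements of a product of operators of
disjoint subsystems, one of them moved to the left as an adjoint. -/
theorem inner_regroup_regroup {S T : Finset ι} (hST : Disjoint S T) (x y : Π i, H i)
    (p : SubTensor H S) (q : SubTensor H T) :
    ⟪regroup S p (htprod (restr Sᶜ y)), regroup T q (htprod (restr Tᶜ x))⟫_ℂ
      = ⟪p, htprod (restr S x)⟫_ℂ * ⟪htprod (restr T y), q⟫_ℂ
        * ∏ i ∈ (S ∪ T)ᶜ, ⟪y i, x i⟫_ℂ := by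
  have h0 : ∀ (a : Π i : S, H i) (b : Π i : T, H i),
      ⟪regroup S (htprod a) (htprod (restr Sᶜ y)), regroup T (htprod b) (htprod (restr Tᶜ x))⟫_ℂ
      = ⟪htprod a, htprod (restr S x)⟫_ℂ * ⟪htprod (restr T y), htprod b⟫_ℂ
        * ∏ i ∈ (S ∪ T)ᶜ, ⟪y i, x i⟫_ℂ := by
    intro a b
    have ha := regroup_htprod S (glue S a (restr Sᶜ y))
    have hb := regroup_htprod T (glue T b (restr Tᶜ x))
    rw [restr_glue, restr_compl_glue] at ha hb
    rw [ha, hb, inner_htprod, inner_htprod, inner_htprod,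
      ← Finset.prod_mul_prod_compl (S ∪ T), Finset.prod_union hST,
      ← Finset.prod_coe_sort S, ← Finset.prod_coe_sort T]
    congr 1
    · congr 1
      · refine Finset.prod_congr rfl fun i _ => ?_
        have hi : (i : ι) ∉ T := Finset.disjoint_left.1 hST i.2
        simp [glue, restr, hi]
      · refine Finset.prod_congr rfl fun i _ => ?_
        have hi : (i : ι) ∉ S := Finset.disjoint_right.1 hST i.2
        simp [glue, restr, hi]
    · refine Finset.prod_congr rfl fun i hi => ?_
      rw [Finset.mem_compl, Finset.mem_union, not_or] at hi
      simp [glue, restr, hi.1, hi.2]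
  have h1 : ∀ (a : Π i : S, H i) (q : SubTensor H T),
      ⟪regroup S (htprod a) (htprod (restr Sᶜ y)), regroup T q (htprod (restr Tᶜ x))⟫_ℂ
      = ⟪htprod a, htprod (restr S x)⟫_ℂ * ⟪htprod (restr T y), q⟫_ℂ
        * ∏ i ∈ (S ∪ T)ᶜ, ⟪y i, x i⟫_ℂ := by
    intro a q
    have := ext_htprod (A := innerSL ℂ (regroup S (htprod a) (htprod (restr Sᶜ y))) ∘L
        ContinuousLinearMap.adjoint (split T) ∘L tmulL.flip (htprod (restr Tᶜ x)))
      (B := (⟪htprod a, htprod (restr S x)⟫_ℂ * ∏ i ∈ (S ∪ T)ᶜ, ⟪y i, x i⟫_ℂ) •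
        innerSL ℂ (htprod (restr T y))) fun b => by
          refine (h0 a b).trans ?_
          rw [smul_apply, innerSL_apply_apply, smul_eq_mul]
          ring
    refine (DFunLike.congr_fun this q).trans ?_
    rw [smul_apply, innerSL_apply_apply, smul_eq_mul]
    ring
  have := ext_htprod (A := innerSL ℂ (regroup T q (htprod (restr Tᶜ x))) ∘L
        ContinuousLinearMap.adjoint (split S) ∘L tmulL.flip (htprod (restr Sᶜ y)))
      (B := starRingEnd ℂ (⟪htprod (restr T y), q⟫_ℂ * ∏ i ∈ (S ∪ T)ᶜ, ⟪y i, x i⟫_ℂ) •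
        innerSL ℂ (htprod (restr S x))) fun a => by
          change ⟪regroup T q (htprod (restr Tᶜ x)),
            regroup S (htprod a) (htprod (restr Sᶜ y))⟫_ℂ = _
          rw [← inner_conj_symm, h1, smul_apply, innerSL_apply_apply, smul_eq_mul, map_mul, map_mul, map_mul,
            inner_conj_symm (htprod (restr S x))]
          ring
  refine (inner_conj_symm _ _).symm.trans ?_
  refine (congrArg (starRingEnd ℂ) (DFunLike.congr_fun this p)).trans ?_
  rw [smul_apply, innerSL_apply_apply, smul_eq_mul, map_mul, starRingEnd_self_apply,
    inner_conj_symm]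
  ring

/-- Between product vectors, the matrix elements of either product are the same expression,
symmetric in the two subsystems. -/
theorem commute_ampliate {S T : Finset ι} (hST : Disjoint S T)
    (A : SubTensor H S →L[ℂ] SubTensor H S) (B : SubTensor H T →L[ℂ] SubTensor H T) :
    ampliateHom H S A * ampliateHom H T B = ampliateHom H T B * ampliateHom H S A := by
  have key : ∀ {S T : Finset ι} (_ : Disjoint S T)
      (A : SubTensor H S →L[ℂ] SubTensor H S) (B : SubTensor H T →L[ℂ] SubTensor H T)
      (x y : Π i, H i), ⟪htprod y, (ampliateHom H S A * ampliateHom H T B) (htprod x)⟫_ℂ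
        = ⟪htprod (restr S y), A (htprod (restr S x))⟫_ℂ
          * ⟪htprod (restr T y), B (htprod (restr T x))⟫_ℂ * ∏ i ∈ (S ∪ T)ᶜ, ⟪y i, x i⟫_ℂ := by
    intro S T hST A B x y
    rw [mul_apply_eq_comp, ← ContinuousLinearMap.adjoint_inner_left,
      ← ContinuousLinearMap.star_eq_adjoint, ← map_star, ContinuousLinearMap.star_eq_adjoint,
      ampliateHom_apply, ampliateHom_apply, ← regroup_htprod S y, ← regroup_htprod T x,
      ampliate_regroup, ampliate_regroup, inner_regroup_regroup hST,
      ContinuousLinearMap.adjoint_inner_left]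
  refine ext_htprod fun x => ?_
  have h : innerSL ℂ ((ampliateHom H S A * ampliateHom H T B) (htprod x))
      = innerSL ℂ ((ampliateHom H T B * ampliateHom H S A) (htprod x)) := by
    refine ext_htprod fun y => ?_
    have e : ⟪htprod y, (ampliateHom H S A * ampliateHom H T B) (htprod x)⟫_ℂ
        = ⟪htprod y, (ampliateHom H T B * ampliateHom H S A) (htprod x)⟫_ℂ := by
      rw [key hST, key hST.symm, Finset.union_comm T S]
      ring
    rw [innerSL_apply_apply, innerSL_apply_apply]
    exact (inner_conj_symm _ _).symm.trans ((congrArg _ e).trans (inner_conj_symm _ _))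
  exact ext_inner_right ℂ fun z => by simpa using DFunLike.congr_fun h z

end Split

/-! ### Norm estimates for orthogonal projections -/

section Projection

variable {K : Type*} [NormedAddCommGroup K] [InnerProductSpace ℂ K] [CompleteSpace K]

theorem re_inner_star_mul_self (W : K →L[ℂ] K) (v : K) :
    RCLike.re ⟪v, (star W * W) v⟫_ℂ = ‖W v‖ ^ 2 := by
  rw [mul_apply_eq_comp, ContinuousLinearMap.star_eq_adjoint,
    ContinuousLinearMap.adjoint_inner_right, inner_self_eq_norm_sq]

variable {p : K →L[ℂ] K}

theorem re_inner_projection (hp : IsStarProjection p) (x : K) :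
    RCLike.re ⟪x, p x⟫_ℂ = ‖p x‖ ^ 2 := by
  rw [← re_inner_star_mul_self, hp.isSelfAdjoint.star_eq, hp.isIdempotentElem.eq]

theorem norm_sq_projection_add (hp : IsStarProjection p) (x : K) :
    ‖p x‖ ^ 2 + ‖x - p x‖ ^ 2 = ‖x‖ ^ 2 := by
  have h := re_inner_projection hp.one_sub x
  have e : (1 - p) x = x - p x := rfl
  rw [e, inner_sub_right, map_sub, re_inner_projection hp, inner_self_eq_norm_sq] at h
  linarith

theorem norm_projection_le (hp : IsStarProjection p) (x : K) : ‖p x‖ ≤ ‖x‖ := by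
  have h := norm_sq_projection_add hp x
  exact le_of_sq_le_sq (by nlinarith [sq_nonneg ‖x - p x‖]) (norm_nonneg _)

/-- `p x` is the point of the range of `p` nearest to `x`. -/
theorem norm_sub_projection_le (hp : IsStarProjection p) {x y : K} (hy : p y = y) :
    ‖x - p x‖ ≤ ‖x - y‖ := by
  have h := norm_projection_le hp.one_sub (x - y)
  have e : (1 - p) (x - y) = x - p x := by
    change (x - y) - p (x - y) = x - p x
    rw [map_sub, hy]
    abel
  rwa [e] at h

end Projection

/-! ### Slices of a vector and maximal correlation -/

section MatrixUnit

variable {E K : Type*} [NormedAddCommGroup E] [InnerProductSpace ℂ E] [CompleteSpace E]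
  [NormedAddCommGroup K] [InnerProductSpace ℂ K] [CompleteSpace K]
  (φ : (E →L[ℂ] E) →⋆ₐ[ℂ] (K →L[ℂ] K))

/-- The image of the rank one operator `|e⟩⟨f|`. -/
def matrixUnit (e f : E) : K →L[ℂ] K := φ (InnerProductSpace.rankOne ℂ e f)

theorem matrixUnit_mul (a b c d : E) :
    matrixUnit φ a b * matrixUnit φ c d = ⟪b, c⟫_ℂ • matrixUnit φ a d := by
  rw [matrixUnit, matrixUnit, ← map_mul, matrixUnit, ← map_smul]
  exact congrArg φ (InnerProductSpace.rankOne_comp_rankOne a b c d)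

theorem star_matrixUnit (a b : E) : star (matrixUnit φ a b) = matrixUnit φ b a := by
  rw [matrixUnit, ← map_star, ContinuousLinearMap.star_eq_adjoint,
    InnerProductSpace.adjoint_rankOne, matrixUnit]

theorem matrixUnit_mul_of_norm_eq_one {e₀ : E} (he₀ : ‖e₀‖ = 1) (a b : E) :
    matrixUnit φ a e₀ * matrixUnit φ e₀ b = matrixUnit φ a b := by
  rw [matrixUnit_mul, inner_self_eq_norm_sq_to_K, he₀]
  simp

/-- The map `e ↦ |e₀⟩⟨e| v`. -/
def slice (e₀ : E) (v : K) : E →ₗ⋆[ℂ] K where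
  toFun e := matrixUnit φ e₀ e v
  map_add' a b := by simp [matrixUnit]
  map_smul' c a := by simp [matrixUnit]

variable {φ}

theorem slice_apply (e₀ : E) (v : K) (e : E) : slice φ e₀ v e = matrixUnit φ e₀ e v := rfl

theorem matrixUnit_slice {e₀ : E} (he₀ : ‖e₀‖ = 1) (v : K) (e a : E) :
    matrixUnit φ a e₀ (slice φ e₀ v e) = matrixUnit φ a e v := by
  rw [slice_apply, ← mul_apply_eq_comp, matrixUnit_mul_of_norm_eq_one φ he₀]

/-- |f⟩⟨f| = W*W with W = |e₀⟩⟨f|, and W v is the slice at f. Probabilities thus become squared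
norms of slices. -/
theorem prob_matrixUnit {e₀ : E} (he₀ : ‖e₀‖ = 1) (v : K) (f : E) :
    prob v (matrixUnit φ f f) = ‖slice φ e₀ v f‖ ^ 2 := by
  rw [prob, ← matrixUnit_mul_of_norm_eq_one φ he₀, ← star_matrixUnit φ e₀ f,
    re_inner_star_mul_self, slice_apply]

theorem prob_mul_matrixUnit {e₀ : E} (he₀ : ‖e₀‖ = 1) {p : K →L[ℂ] K} (hp : IsStarProjection p)
    (hcomm : ∀ A, p * φ A = φ A * p) (v : K) (f : E) :
    prob v (p * matrixUnit φ f f) = ‖p (slice φ e₀ v f)‖ ^ 2 := by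
  have h : p * matrixUnit φ f f = star (p * matrixUnit φ e₀ f) * (p * matrixUnit φ e₀ f) := by
    rw [star_mul, star_matrixUnit, hp.isSelfAdjoint.star_eq, mul_assoc, ← mul_assoc p,
      hp.isIdempotentElem.eq, ← mul_assoc, matrixUnit, matrixUnit, matrixUnit, ← hcomm, mul_assoc]
    congr 1
    exact (matrixUnit_mul_of_norm_eq_one φ he₀ f f).symm
  rw [prob, h, re_inner_star_mul_self, slice_apply]
  rfl

variable (φ) in
/-- The slices `⟨e| v`, regarded as elements of `e₀ ⊗ _`, are dense. -/
def DenseSlices (e₀ : E) (v : K) : Prop :=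
  ∀ (y : K) (δ : ℝ), 0 < δ → ∃ e, ‖slice φ e₀ v e - matrixUnit φ e₀ e₀ y‖ < δ

theorem DenseSlices.smul {e₀ : E} {v : K} (h : DenseSlices φ e₀ v) {c : ℂ} (hc : c ≠ 0) :
    DenseSlices φ e₀ (c • v) := by
  intro y δ hδ
  obtain ⟨e, he⟩ := h y δ hδ
  refine ⟨star c⁻¹ • e, ?_⟩
  have : slice φ e₀ (c • v) (star c⁻¹ • e) = slice φ e₀ v e := by
    rw [LinearMap.map_smulₛₗ, slice_apply, map_smul, smul_smul, slice_apply]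
    simp [hc]
  rwa [this]

/-- For a slice w at f, the conditional probability given |f⟩⟨f| (f normalized) is ‖p w‖² / ‖w‖². It
is close to 1 once w is close to a nonzero vector of the range of p. -/
theorem DenseSlices.maximallyCorrelated {e₀ : E} (he₀ : ‖e₀‖ = 1)
    (hφ : ∀ z, (∀ e, slice φ e₀ z e = 0) → z = 0) {𝒜 : Set (K →L[ℂ] K)}
    (hcomm : ∀ p ∈ 𝒜, ∀ A, p * φ A = φ A * p) {v : K} (hv : DenseSlices φ e₀ v) :
    MaximallyCorrelated 𝒜 (Set.range φ) v := by
  intro p hp𝒜 hp hp0 ε hε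
  obtain ⟨u, hu⟩ : ∃ u, p u ≠ 0 := by
    by_contra! h
    exact hp0 (ContinuousLinearMap.ext h)
  obtain ⟨e, he⟩ : ∃ e, slice φ e₀ (p u) e ≠ 0 := by
    by_contra! h
    exact hu (hφ _ h)
  -- Slicing commutes with `p`, so `y` stays in the range of `p`; being a slice, it is fixed by
  -- |e₀⟩⟨e₀| and can be approximated by slices of `v`.
  set y := slice φ e₀ (p u) e with hy
  have hpy : p y = y := by
    rw [hy, slice_apply, matrixUnit, ← mul_apply_eq_comp, ← mul_apply_eq_comp,
      hcomm p hp𝒜, mul_assoc, hp.isIdempotentElem.eq]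
    rfl
  have hy0 : 0 < ‖y‖ := norm_pos_iff.2 he
  set η := min 1 ε with hη
  have hη0 : 0 < η := lt_min one_pos hε
  have hη1 : η ≤ 1 := min_le_left _ _
  -- The tolerance gives ‖w‖ > ‖y‖ / 2, hence ‖w - p w‖ < η ‖w‖; the loss in probability is then
  -- below η² ≤ ε, because η ≤ 1 and η ≤ ε.
  obtain ⟨f, hf⟩ := hv y (‖y‖ / 2 * η) (by positivity)
  rw [matrixUnit_slice he₀, ← slice_apply, ← hy] at hf
  set w := slice φ e₀ v f with hw
  have hwp : ‖w - p w‖ < ‖y‖ / 2 * η := (norm_sub_projection_le hp hpy).trans_lt hf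
  have hwn : ‖y‖ / 2 < ‖w‖ := by
    have h1 : ‖y‖ ≤ ‖w‖ + ‖w - y‖ := by
      rw [norm_sub_rev]
      simpa using norm_add_le w (y - w)
    nlinarith
  have hsq := norm_sq_projection_add hp w
  have hw0 : 0 < ‖w‖ := by linarith
  have hf0 : f ≠ 0 := by
    rintro rfl
    rw [hw, map_zero, norm_zero] at hw0
    exact lt_irrefl _ hw0
  have hfn : 0 < ‖f‖ := norm_pos_iff.2 hf0
  set c : ℂ := ((‖f‖⁻¹ : ℝ) : ℂ) with hc
  have hcn : ‖c‖ = ‖f‖⁻¹ := by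
    rw [hc, Complex.norm_real, Real.norm_of_nonneg (by positivity)]
  have hs : slice φ e₀ v (c • f) = starRingEnd ℂ c • w := LinearMap.map_smulₛₗ _ _ _
  have hcf : ‖c • f‖ = 1 := by
    rw [norm_smul, hcn, inv_mul_cancel₀ hfn.ne']
  have hP1 : prob v (matrixUnit φ (c • f) (c • f)) = ‖c‖ ^ 2 * ‖w‖ ^ 2 := by
    rw [prob_matrixUnit he₀, hs, norm_smul, RCLike.norm_conj, mul_pow]
  have hP2 : prob v (p * matrixUnit φ (c • f) (c • f)) = ‖c‖ ^ 2 * ‖p w‖ ^ 2 := by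
    rw [prob_mul_matrixUnit he₀ hp (hcomm p hp𝒜), hs, map_smul, norm_smul, RCLike.norm_conj,
      mul_pow]
  have hcp : 0 < ‖c‖ := by rw [hcn]; positivity
  have hpos : 0 < prob v (matrixUnit φ (c • f) (c • f)) := by rw [hP1]; positivity
  refine ⟨matrixUnit φ (c • f) (c • f), ⟨_, rfl⟩,
    (InnerProductSpace.isStarProjection_rankOne_self hcf).map φ, ?_, hpos, ?_⟩
  · intro h0
    rw [h0] at hpos
    simp [prob] at hpos
  · change 1 - ε < prob v (p * matrixUnit φ (c • f) (c • f)) / _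
    rw [lt_div_iff₀ hpos, hP1, hP2]
    have h3 : ‖w - p w‖ ^ 2 < ε * ‖w‖ ^ 2 := by
      have h4 : ‖w - p w‖ < ‖w‖ * η := hwp.trans (mul_lt_mul_of_pos_right hwn hη0)
      calc ‖w - p w‖ ^ 2 < (‖w‖ * η) ^ 2 := pow_lt_pow_left₀ h4 (norm_nonneg _) two_ne_zero
        _ = η ^ 2 * ‖w‖ ^ 2 := by ring
        _ ≤ ε * ‖w‖ ^ 2 := by
          refine mul_le_mul_of_nonneg_right ?_ (by positivity)
          have : η ≤ ε := min_le_right _ _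
          nlinarith
    have h5 : (1 - ε) * ‖w‖ ^ 2 < ‖p w‖ ^ 2 := by linarith
    nlinarith [mul_lt_mul_of_pos_left h5 (pow_pos hcp 2)]

theorem isOpen_setOf_exists_slice (e₀ : E) (y : K) (δ : ℝ) :
    IsOpen {v | ∃ e, ‖slice φ e₀ v e - matrixUnit φ e₀ e₀ y‖ < δ} := by
  rw [Set.ofPred_exists]
  refine isOpen_iUnion fun e => ?_
  simp only [slice_apply]
  exact isOpen_lt (by fun_prop) continuous_const

/-- If the slice at a unit vector e is small, so is the component of v along e. Replacing this
component by η e ⊗ y moves v only slightly and makes the target the slice at e / η. -/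
theorem dense_setOf_exists_slice {e₀ : E} (he₀ : ‖e₀‖ = 1) {y : K}
    (h : ∀ (v : K) (δ : ℝ), 0 < δ → (∃ e, ‖e‖ = 1 ∧ ‖slice φ e₀ v e‖ < δ) ∨
      ∃ e, slice φ e₀ v e = matrixUnit φ e₀ e₀ y) {δ : ℝ} (hδ : 0 < δ) :
    Dense {v | ∃ e, ‖slice φ e₀ v e - matrixUnit φ e₀ e₀ y‖ < δ} := by
  rw [Metric.dense_iff]
  intro v r hr
  rcases h v (r / 2) (by positivity) with ⟨e, he, hev⟩ | ⟨e, he⟩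
  swap
  · exact ⟨v, Metric.mem_ball_self hr, e, by rwa [he, sub_self, norm_zero]⟩
  obtain ⟨η, hη0, hη⟩ : ∃ η : ℝ, 0 < η ∧ η * ‖matrixUnit φ e e₀ y‖ < r / 2 := by
    refine ⟨r / 2 / (‖matrixUnit φ e e₀ y‖ + 1), by positivity, ?_⟩
    rw [div_mul_eq_mul_div, div_lt_iff₀ (by positivity)]
    nlinarith
  have hη' : (η : ℂ) ≠ 0 := by exact_mod_cast hη0.ne'
  -- The norm of a slice does not depend on the reference unit vector, so `e` may replace `e₀`.
  have hself : ‖matrixUnit φ e e v‖ = ‖slice φ e₀ v e‖ := by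
    have h1 := prob_matrixUnit (φ := φ) he₀ v e
    have h2 := prob_matrixUnit (φ := φ) he v e
    rw [h1, slice_apply e] at h2
    exact ((pow_left_inj₀ (norm_nonneg _) (norm_nonneg _) two_ne_zero).1 h2).symm
  refine ⟨v - matrixUnit φ e e v + (η : ℂ) • matrixUnit φ e e₀ y, ?_, star (η : ℂ)⁻¹ • e, ?_⟩
  · rw [mem_ball_iff_norm]
    have : v - matrixUnit φ e e v + (η : ℂ) • matrixUnit φ e e₀ y - v
        = (η : ℂ) • matrixUnit φ e e₀ y - matrixUnit φ e e v := by abel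
    rw [this]
    refine (norm_sub_le _ _).trans_lt ?_
    rw [norm_smul, hself, Complex.norm_real, Real.norm_of_nonneg hη0.le]
    linarith
  · have h3 : ∀ z, matrixUnit φ e₀ e (matrixUnit φ e e z) = matrixUnit φ e₀ e z := fun z =>
      matrixUnit_slice he z e e₀
    have h4 : matrixUnit φ e₀ e (matrixUnit φ e e₀ y) = matrixUnit φ e₀ e₀ y :=
      matrixUnit_slice he y e₀ e₀
    rw [LinearMap.map_smulₛₗ, slice_apply, map_add, map_sub, h3, sub_self, zero_add, map_smul, h4,
      smul_smul]
    simpa [hη'] using hδ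

/-- Bessel's inequality: the squared norms of the slices along an orthonormal sequence sum to at
most ‖v‖², so they cannot all be at least δ². -/
theorem exists_norm_slice_lt {x : ℕ → E} (hx : Orthonormal ℂ x) {e₀ : E} (he₀ : ‖e₀‖ = 1)
    (v : K) {δ : ℝ} (hδ : 0 < δ) : ∃ e, ‖e‖ = 1 ∧ ‖slice φ e₀ v e‖ < δ := by
  by_contra! h
  have hb : ∀ N : ℕ, N * δ ^ 2 ≤ ‖v‖ ^ 2 := by
    intro N
    have hp : IsStarProjection (∑ k ∈ Finset.range N, matrixUnit φ (x k) (x k)) := by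
      constructor
      · rw [IsIdempotentElem, Finset.sum_mul_sum]
        refine Finset.sum_congr rfl fun i hi => ?_
        rw [Finset.sum_eq_single_of_mem i hi, matrixUnit_mul_of_norm_eq_one φ (hx.1 i)]
        intro j _ hj
        rw [matrixUnit_mul, hx.2 hj.symm, zero_smul]
      · rw [IsSelfAdjoint, star_sum]
        exact Finset.sum_congr rfl fun i _ => star_matrixUnit φ _ _
    have h1 := re_inner_projection hp v
    have h2 : RCLike.re ⟪v, (∑ k ∈ Finset.range N, matrixUnit φ (x k) (x k)) v⟫_ℂ
        = ∑ k ∈ Finset.range N, ‖slice φ e₀ v (x k)‖ ^ 2 := by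
      rw [sum_apply, inner_sum, map_sum]
      exact Finset.sum_congr rfl fun k _ => prob_matrixUnit he₀ v (x k)
    have h3 : (N : ℝ) * δ ^ 2 ≤ ∑ k ∈ Finset.range N, ‖slice φ e₀ v (x k)‖ ^ 2 := by
      have := Finset.card_nsmul_le_sum (Finset.range N)
        (fun k => ‖slice φ e₀ v (x k)‖ ^ 2) (δ ^ 2)
        fun k _ => pow_le_pow_left₀ hδ.le (h (x k) (hx.1 k)) 2
      simpa using this
    rw [← h2, h1] at h3
    exact h3.trans (pow_le_pow_left₀ (norm_nonneg _) (norm_projection_le hp v) 2)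
  obtain ⟨N, hN⟩ := exists_nat_gt (‖v‖ ^ 2 / δ ^ 2)
  rw [div_lt_iff₀ (by positivity)] at hN
  exact absurd (hb N) (not_le.2 hN)

/-- All slices lie in the range of |e₀⟩⟨e₀|, whose dimension is at most that of `E`. An injective
slice map therefore carries a basis to a basis of that range. -/
theorem exists_slice_eq_zero_or_eq [FiniteDimensional ℂ E] {e₀ : E} (he₀ : ‖e₀‖ = 1)
    [FiniteDimensional ℂ (matrixUnit φ e₀ e₀).range]
    (hdim : Module.finrank ℂ (matrixUnit φ e₀ e₀).range ≤ Module.finrank ℂ E) (v y : K) :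
    (∃ e, ‖e‖ = 1 ∧ slice φ e₀ v e = 0) ∨ ∃ e, slice φ e₀ v e = matrixUnit φ e₀ e₀ y := by
  by_cases hinj : ∀ e, slice φ e₀ v e = 0 → e = 0
  swap
  · push Not at hinj
    obtain ⟨e, he, he0⟩ := hinj
    refine Or.inl ⟨((‖e‖⁻¹ : ℝ) : ℂ) • e, ?_, ?_⟩
    · rw [norm_smul, Complex.norm_real, norm_inv, norm_norm,
        inv_mul_cancel₀ (norm_ne_zero_iff.2 he0)]
    · rw [LinearMap.map_smulₛₗ, he, smul_zero]
  right
  set b := Module.finBasis ℂ E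
  have hmem : ∀ e, slice φ e₀ v e ∈ (matrixUnit φ e₀ e₀).range := fun e =>
    ⟨slice φ e₀ v e, matrixUnit_slice he₀ v e e₀⟩
  have hli : LinearIndependent ℂ fun i =>
      (⟨slice φ e₀ v (b i), hmem _⟩ : (matrixUnit φ e₀ e₀).range) := by
    rw [Fintype.linearIndependent_iff]
    intro g hg
    have h1 : slice φ e₀ v (∑ i, star (g i) • b i) = 0 := by
      have := congrArg Subtype.val hg
      simp only [Submodule.coe_sum, Submodule.coe_smul, ZeroMemClass.coe_zero] at this
      rw [map_sum]
      simpa using this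
    intro i
    simpa using Fintype.linearIndependent_iff.1 b.linearIndependent _ (hinj _ h1) i
  have hcard : Fintype.card (Fin (Module.finrank ℂ E))
      = Module.finrank ℂ (matrixUnit φ e₀ e₀).range :=
    le_antisymm hli.fintype_card_le_finrank (by simpa using hdim)
  have hy : (⟨matrixUnit φ e₀ e₀ y, ⟨y, rfl⟩⟩ : (matrixUnit φ e₀ e₀).range)
      ∈ Submodule.span ℂ (Set.range fun i =>
        (⟨slice φ e₀ v (b i), hmem _⟩ : (matrixUnit φ e₀ e₀).range)) := by
    rw [hli.span_eq_top_of_card_eq_finrank' hcard]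
    exact Submodule.mem_top
  obtain ⟨g, hg⟩ := (Submodule.mem_span_range_iff_exists_fun ℂ).1 hy
  refine ⟨∑ i, star (g i) • b i, ?_⟩
  have := congrArg Subtype.val hg
  simp only [Submodule.coe_sum, Submodule.coe_smul] at this
  rw [map_sum, ← this]
  simp

/-- Each `p j` is almost certified by one vector `f j` of `E`, whose slice almost lies in the range
of `p j`. Slices close to mutually orthogonal ranges are linearly independent, hence so are the `f
j`. -/
theorem card_le_finrank_of_maximallyCorrelated [FiniteDimensional ℂ E] {e₀ : E} (he₀ : ‖e₀‖ = 1)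
    {𝒜 : Set (K →L[ℂ] K)} (hcomm : ∀ p ∈ 𝒜, ∀ A, p * φ A = φ A * p) {v : K}
    (hv : MaximallyCorrelated 𝒜 (Set.range φ) v) {k : ℕ} {p : Fin k → K →L[ℂ] K}
    (hp𝒜 : ∀ j, p j ∈ 𝒜) (hp : ∀ j, IsStarProjection (p j)) (hp0 : ∀ j, p j ≠ 0)
    (hpp : ∀ i j, i ≠ j → p i * p j = 0) : k ≤ Module.finrank ℂ E := by
  -- Chosen so that k η < 1. Correlation is used with ε = η², which bounds the distance of a slice
  -- from the range by η times its norm.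
  set η : ℝ := 1 / (k + 1) with hη
  have hη0 : 0 < η := by positivity
  have hex : ∀ j, ∃ f, (1 - η ^ 2) * ‖slice φ e₀ v f‖ ^ 2 < ‖p j (slice φ e₀ v f)‖ ^ 2 := by
    intro j
    obtain ⟨P, ⟨A, rfl⟩, hP, -, hpos, hcond⟩ :=
      hv (p j) (hp𝒜 j) (hp j) (hp0 j) (η ^ 2) (by positivity)
    set b := stdOrthonormalBasis ℂ E
    -- Only `φ A` is known to be a projection, since `φ` is not assumed injective; hence A is
    -- replaced by A A*, a sum of rank one operators.
    have hsum : φ A = ∑ i, matrixUnit φ (A (b i)) (A (b i)) := by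
      have h1 : φ A = φ (A * star A) := by
        rw [map_mul, map_star, hP.isSelfAdjoint.star_eq, hP.isIdempotentElem.eq]
      have h2 : A * star A = ∑ i, InnerProductSpace.rankOne ℂ (A (b i)) (A (b i)) := by
        have h3 : ∀ i, InnerProductSpace.rankOne ℂ (A (b i)) (A (b i))
            = A * InnerProductSpace.rankOne ℂ (b i) (b i) * star A := by
          intro i
          ext z
          simp [ContinuousLinearMap.star_eq_adjoint, ContinuousLinearMap.adjoint_inner_right]
        simp only [h3]
        rw [← Finset.sum_mul, ← Finset.mul_sum, b.sum_rankOne_eq_id]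
        rfl
      rw [h1, h2, map_sum]
      rfl
    have hP1 : prob v (φ A) = ∑ i, ‖slice φ e₀ v (A (b i))‖ ^ 2 := by
      conv_lhs => rw [hsum]
      rw [prob, sum_apply, inner_sum, map_sum]
      exact Finset.sum_congr rfl fun i _ => prob_matrixUnit he₀ v _
    have hP2 : prob v (p j * φ A) = ∑ i, ‖p j (slice φ e₀ v (A (b i)))‖ ^ 2 := by
      conv_lhs => rw [hsum]
      rw [prob, Finset.mul_sum, sum_apply, inner_sum, map_sum]
      exact Finset.sum_congr rfl fun i _ => prob_mul_matrixUnit he₀ (hp j) (hcomm _ (hp𝒜 j)) v _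
    change _ < prob v (p j * φ A) / _ at hcond
    rw [lt_div_iff₀ hpos, hP1, hP2, Finset.mul_sum] at hcond
    -- An inequality between sums over the rank one pieces holds strictly for at least one piece.
    obtain ⟨i, -, hi⟩ := Finset.exists_lt_of_sum_lt hcond
    exact ⟨_, hi⟩
  choose f hf using hex
  set w := fun j => slice φ e₀ v (f j) with hw
  have hsmall : ∀ i, ‖w i - p i (w i)‖ ≤ η * ‖w i‖ := by
    intro i
    have h1 := norm_sq_projection_add (hp i) (w i)
    have h2 := hf i
    refine le_of_sq_le_sq ?_ (by positivity)
    rw [mul_pow]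
    simp only [hw] at h1 ⊢
    nlinarith
  have hwpos : ∀ i, 0 < ‖w i‖ := by
    intro i
    by_contra h
    have h0 : w i = 0 := norm_eq_zero.1 (le_antisymm (not_lt.1 h) (norm_nonneg _))
    have h2 := hf i
    simp only [hw] at h0
    rw [h0] at h2
    simp at h2
  have hoff : ∀ i j, i ≠ j → ‖p j (w i)‖ ≤ η * ‖w i‖ := by
    intro i j hij
    have h1 : p j (w i) = p j (w i - p i (w i)) := by
      rw [map_sub, ← mul_apply_eq_comp, hpp j i hij.symm]
      simp
    rw [h1]
    exact (norm_projection_le (hp j) _).trans (hsmall i)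
  have hli : LinearIndependent ℂ f := by
    rw [Fintype.linearIndependent_iff]
    intro g hg
    have hsum : ∑ i, star (g i) • w i = 0 := by
      have h1 : slice φ e₀ v (∑ i, g i • f i) = 0 := by rw [hg, map_zero]
      rw [map_sum] at h1
      simpa using h1
    have hj : ∀ j, ‖g j‖ * ‖w j‖ ≤ η * ∑ i, ‖g i‖ * ‖w i‖ := by
      intro j
      -- Applying `p j` to the linear relation expresses the term of `p j (w j)` through the small
      -- off-diagonal terms.
      have h1 : star (g j) • w j = star (g j) • (w j - p j (w j))
          - ∑ i ∈ Finset.univ.erase j, star (g i) • p j (w i) := by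
        have h2 := congrArg (p j) hsum
        rw [map_sum, map_zero, ← Finset.add_sum_erase _ _ (Finset.mem_univ j)] at h2
        simp only [map_smul] at h2
        rw [smul_sub, sub_sub, h2, sub_zero]
      calc ‖g j‖ * ‖w j‖ = ‖star (g j) • w j‖ := by rw [norm_smul, norm_star]
        _ ≤ ‖star (g j) • (w j - p j (w j))‖
          + ‖∑ i ∈ Finset.univ.erase j, star (g i) • p j (w i)‖ := by
            rw [h1]; exact norm_sub_le _ _
        _ ≤ ‖g j‖ * (η * ‖w j‖)
          + ∑ i ∈ Finset.univ.erase j, ‖g i‖ * (η * ‖w i‖) := by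
            refine add_le_add ?_ ((norm_sum_le _ _).trans (Finset.sum_le_sum fun i hi => ?_))
            · rw [norm_smul, norm_star]
              exact mul_le_mul_of_nonneg_left (hsmall j) (norm_nonneg _)
            · rw [norm_smul, norm_star]
              exact mul_le_mul_of_nonneg_left (hoff i j (Finset.ne_of_mem_erase hi))
                (norm_nonneg _)
        _ = η * ∑ i, ‖g i‖ * ‖w i‖ := by
            rw [Finset.add_sum_erase _ (fun i => ‖g i‖ * (η * ‖w i‖)) (Finset.mem_univ j),
              Finset.mul_sum]
            exact Finset.sum_congr rfl fun i _ => by ring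
    have hC0 : 0 ≤ ∑ i, ‖g i‖ * ‖w i‖ := Finset.sum_nonneg fun i _ => by positivity
    have hC : ∑ i, ‖g i‖ * ‖w i‖ ≤ k * (η * ∑ i, ‖g i‖ * ‖w i‖) := by
      refine (Finset.sum_le_sum fun j _ => hj j).trans ?_
      simp
    have hkη : k * η < 1 := by
      rw [hη, mul_one_div, div_lt_one (by positivity)]
      linarith
    -- The sum C is nonnegative and satisfies C ≤ (k η) C with k η < 1.
    have hC' : ∑ i, ‖g i‖ * ‖w i‖ = 0 := by nlinarith
    intro j
    have h3 := (Finset.sum_eq_zero_iff_of_nonneg fun i _ => by positivity).1 hC' j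
      (Finset.mem_univ j)
    exact norm_eq_zero.1 ((mul_eq_zero.1 h3).resolve_right (hwpos j).ne')
  simpa using hli.fintype_card_le_finrank

end MatrixUnit

/-! ### Hilbert dimension of separable spaces -/

section Dimension

variable {E : Type u} [NormedAddCommGroup E] [InnerProductSpace ℂ E]

/-- Distinct orthonormal vectors are √2 apart, so the balls of radius 1/2 around them are disjoint
open sets. -/
theorem countable_of_orthonormal [TopologicalSpace.SeparableSpace E] {α : Type*} {x : α → E}
    (hx : Orthonormal ℂ x) : Countable α := by
  refine Pairwise.countable_of_isOpen_disjoint (s := fun a => Metric.ball (x a) (1 / 2))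
    (fun a b hab => ?_) (fun a => Metric.isOpen_ball)
    fun a => ⟨x a, Metric.mem_ball_self (by norm_num)⟩
  refine Metric.ball_disjoint_ball ?_
  have h := norm_sub_sq (𝕜 := ℂ) (x a) (x b)
  rw [hx.2 hab, hx.1, hx.1] at h
  rw [dist_eq_norm]
  norm_num at h ⊢
  nlinarith [norm_nonneg (x a - x b)]

/-- Cardinals are well-ordered, so the infimum is attained as soon as one Hilbert basis exists. -/
theorem exists_mk_eq_hilbertDim (E : Type u) [NormedAddCommGroup E] [InnerProductSpace ℂ E]
    [CompleteSpace E] : ∃ w : Set E, Orthonormal ℂ ((↑) : w → E) ∧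
      (Submodule.span ℂ w).topologicalClosure = ⊤ ∧ Cardinal.mk w = hilbertDim E := by
  obtain ⟨w, b, hb⟩ := exists_hilbertBasis ℂ E
  refine csInf_mem (s := {κ | ∃ w : Set E, Orthonormal ℂ ((↑) : w → E) ∧
    (Submodule.span ℂ w).topologicalClosure = ⊤ ∧ Cardinal.mk w = κ}) ⟨_, w, ?_, ?_, rfl⟩
  · rw [← hb]; exact b.orthonormal
  · have := b.dense_span
    rwa [hb, Subtype.range_coe] at this

theorem span_eq_top_of_finite {w : Set E} (hw : w.Finite)
    (hd : (Submodule.span ℂ w).topologicalClosure = ⊤) : Submodule.span ℂ w = ⊤ := by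
  have := FiniteDimensional.span_of_finite ℂ hw
  rw [← hd]
  exact (Submodule.closed_of_finiteDimensional _).submodule_topologicalClosure_eq.symm

theorem hilbertDim_eq_finrank [CompleteSpace E] [FiniteDimensional ℂ E] :
    hilbertDim E = Module.finrank ℂ E := by
  obtain ⟨w, hw, hd, hc⟩ := exists_mk_eq_hilbertDim E
  have hfin : w.Finite := hw.linearIndependent.setFinite
  have hs := span_eq_top_of_finite hfin hd
  have b := Module.Basis.mk hw.linearIndependent (by rw [Subtype.range_coe, hs])
  rw [← hc, b.mk_eq_rank'', Module.finrank_eq_rank]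

theorem infinite_of_not_finiteDimensional (h : ¬ FiniteDimensional ℂ E) {w : Set E}
    (hd : (Submodule.span ℂ w).topologicalClosure = ⊤) : w.Infinite := by
  intro hfin
  have hs := span_eq_top_of_finite hfin hd
  have := FiniteDimensional.span_of_finite ℂ hfin
  rw [hs] at this
  exact h (Module.finite_def.2 (Module.Finite.iff_fg.1 this))

theorem hilbertDim_eq_aleph0 [CompleteSpace E] [TopologicalSpace.SeparableSpace E]
    (h : ¬ FiniteDimensional ℂ E) : hilbertDim E = Cardinal.aleph0 := by
  obtain ⟨w, hw, hd, hc⟩ := exists_mk_eq_hilbertDim E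
  have := countable_of_orthonormal hw
  have := (infinite_of_not_finiteDimensional h hd).to_subtype
  rw [← hc]
  exact Cardinal.mk_eq_aleph0 w

theorem exists_orthonormal_nat [CompleteSpace E] (h : ¬ FiniteDimensional ℂ E) :
    ∃ x : ℕ → E, Orthonormal ℂ x := by
  obtain ⟨w, hw, hd, -⟩ := exists_mk_eq_hilbertDim E
  have := (infinite_of_not_finiteDimensional h hd).to_subtype
  exact ⟨_, hw.comp _ (Infinite.natEmbedding w).injective⟩

theorem finiteDimensional_iff_hilbertDim_lt [CompleteSpace E]
    [TopologicalSpace.SeparableSpace E] :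
    FiniteDimensional ℂ E ↔ hilbertDim E < Cardinal.aleph0 := by
  constructor
  · intro h
    rw [hilbertDim_eq_finrank]
    exact Cardinal.natCast_lt_aleph0
  · intro h
    by_contra h'
    rw [hilbertDim_eq_aleph0 h'] at h
    exact lt_irrefl _ h

theorem exists_norm_eq_one_of_hilbertDim [CompleteSpace E] (h : 1 < hilbertDim E) :
    ∃ x : E, ‖x‖ = 1 := by
  obtain ⟨w, hw, hd, hc⟩ := exists_mk_eq_hilbertDim E
  have : Cardinal.mk w ≠ 0 := by
    rw [hc]
    exact (zero_lt_one.trans h).ne'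
  obtain ⟨x⟩ := Cardinal.mk_ne_zero_iff.1 this
  exact ⟨x, hw.1 x⟩

end Dimension

/-! ### Embedding the factors by means of a fixed product vector -/

section ProductVectors

variable {ι : Type v} [Fintype ι] [DecidableEq ι] {H : ι → Type u}
  [∀ i, NormedAddCommGroup (H i)] [∀ i, InnerProductSpace ℂ (H i)]
  {x : Π i, H i} (hx : ∀ i, ‖x i‖ = 1)

include hx

theorem norm_htprod_eq_one : ‖htprod x‖ = 1 := by
  rw [norm_htprod]
  exact Finset.prod_eq_one fun i _ => hx i

theorem inner_htprod_update (i : ι) (a b : H i) :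
    ⟪htprod (Function.update x i a), htprod (Function.update x i b)⟫_ℂ = ⟪a, b⟫_ℂ := by
  rw [inner_htprod, Finset.prod_eq_single i]
  · simp
  · intro j _ hj
    simp [hj, inner_self_eq_norm_sq_to_K, hx]
  · simp

theorem inner_htprod_update_update {i j : ι} (hij : i ≠ j) (a b : H i) (c d : H j) :
    ⟪htprod (Function.update (Function.update x i a) j c),
      htprod (Function.update (Function.update x i b) j d)⟫_ℂ = ⟪a, b⟫_ℂ * ⟪c, d⟫_ℂ := by
  rw [inner_htprod, Finset.prod_eq_mul i j hij]
  · simp [hij]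
  · intro k _ hk
    simp [hk.1, hk.2, inner_self_eq_norm_sq_to_K, hx]
  · simp
  · simp

/-- The isometry `a ↦ x ⊗ ⋯ ⊗ a ⊗ ⋯ ⊗ x` with `a` at the place `i`. -/
def insertAt (i : ι) : H i →ₗᵢ[ℂ] HTensor H :=
  (htprod.toLinearMap x i).isometryOfInner (inner_htprod_update hx i)

/-- With a single index, every product vector arises by insertion, and a finite-dimensional range is
closed. -/
theorem range_insertAt {i : ι} (hi : ∀ j, j = i) [FiniteDimensional ℂ (H i)] :
    (insertAt hx i).toLinearMap.range = ⊤ := by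
  refine eq_top_of_htprod_mem (Submodule.closed_of_finiteDimensional _) fun y => ⟨y i, ?_⟩
  change htprod (Function.update x i (y i)) = htprod y
  congr 1
  funext j
  obtain rfl := hi j
  simp

theorem finiteDimensional_of_forall_eq {i : ι} (hi : ∀ j, j = i) [FiniteDimensional ℂ (H i)] :
    FiniteDimensional ℂ (HTensor H) :=
  Module.Finite.of_surjective (insertAt hx i).toLinearMap
    (LinearMap.range_eq_top.1 (range_insertAt hx hi))

theorem finrank_eq_of_forall_eq {i : ι} (hi : ∀ j, j = i) [FiniteDimensional ℂ (H i)] :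
    Module.finrank ℂ (HTensor H) = Module.finrank ℂ (H i) :=
  (LinearEquiv.ofBijective (insertAt hx i).toLinearMap
    ⟨(insertAt hx i).injective, LinearMap.range_eq_top.1 (range_insertAt hx hi)⟩).finrank_eq.symm

theorem finrank_subTensor_singleton (i : ι) [FiniteDimensional ℂ (H i)] :
    FiniteDimensional ℂ (SubTensor H {i}) ∧
      Module.finrank ℂ (SubTensor H {i}) = Module.finrank ℂ (H i) := by
  have hi : ∀ j : ({i} : Finset ι), j = ⟨i, Finset.mem_singleton_self i⟩ := fun j =>
    Subtype.ext (Finset.mem_singleton.1 j.2)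
  have hx' : ∀ j : ({i} : Finset ι), ‖restr {i} x j‖ = 1 := fun j => hx j
  have : FiniteDimensional ℂ (H (⟨i, Finset.mem_singleton_self i⟩ : ({i} : Finset ι))) :=
    inferInstanceAs (FiniteDimensional ℂ (H i))
  exact ⟨finiteDimensional_of_forall_eq hx' hi, finrank_eq_of_forall_eq hx' hi⟩

end ProductVectors

/-! ### Density of the hyperentangled states by Baire category -/

section Generic

variable {ι : Type v} [Fintype ι] [DecidableEq ι] {H : ι → Type u}
  [∀ i, NormedAddCommGroup (H i)] [∀ i, InnerProductSpace ℂ (H i)]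

theorem matrixUnit_regroup (T : Finset ι) (e f a : SubTensor H T) (b : SubTensor H Tᶜ) :
    matrixUnit (ampliateHom H T) e f (regroup T a b) = ⟪f, a⟫_ℂ • regroup T e b := by
  rw [matrixUnit, ampliateHom_apply, ampliate_regroup, InnerProductSpace.rankOne_apply, regroup,
    map_smul, smul_apply, map_smul, regroup]

/-- a ⊗ b is the image of e₀ ⊗ b under |a⟩⟨e₀|, so its inner product with z is that of e₀ ⊗ b with
the slice of z at a. -/
theorem eq_zero_of_slice_eq_zero (T : Finset ι) {e₀ : SubTensor H T} (he₀ : ‖e₀‖ = 1)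
    (z : HTensor H) (h : ∀ e, slice (ampliateHom H T) e₀ z e = 0) : z = 0 := by
  refine eq_zero_of_inner_regroup (S := T) fun a b => ?_
  have h1 : regroup T a b = matrixUnit (ampliateHom H T) a e₀ (regroup T e₀ b) := by
    rw [matrixUnit_regroup, inner_self_eq_norm_sq_to_K, he₀]
    simp
  rw [h1, ← star_matrixUnit, ContinuousLinearMap.star_eq_adjoint,
    ContinuousLinearMap.adjoint_inner_left, ← slice_apply, h, inner_zero_right]

theorem eq_top_of_regroup_mem {T : Finset ι} {M : Submodule ℂ (HTensor H)}
    (hM : IsClosed (M : Set (HTensor H))) (h : ∀ a b, regroup T a b ∈ M) : M = ⊤ := by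
  have h1 := eq_top_of_tmul₂_mem
    (M := M.comap (ContinuousLinearMap.adjoint (split T)).toLinearMap)
    (hM.preimage (ContinuousLinearMap.adjoint (split T)).continuous) h
  rw [eq_top_iff]
  intro z _
  rw [← adjoint_split_split T z]
  exact (h1 ▸ Submodule.mem_top :
    split T z ∈ M.comap (ContinuousLinearMap.adjoint (split T)).toLinearMap)

theorem range_le_of_regroup {T : Finset ι} {F : Type*} [NormedAddCommGroup F] [NormedSpace ℂ F]
    [FiniteDimensional ℂ F] {A : HTensor H →L[ℂ] HTensor H} {L : F →L[ℂ] HTensor H}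
    (h : ∀ a b, A (regroup T a b) ∈ L.range) : A.range ≤ L.range := by
  have hc : IsClosed (L.range : Set (HTensor H)) := Submodule.closed_of_finiteDimensional _
  have h1 := eq_top_of_regroup_mem (T := T) (M := L.range.comap A.toLinearMap)
    (hc.preimage A.continuous) h
  rintro _ ⟨z, rfl⟩
  exact (h1 ▸ Submodule.mem_top : z ∈ L.range.comap A.toLinearMap)

/-- The range of |e₀⟩⟨e₀| ⊗ I lies in e₀ ⊗ H_T', which bounds the dimension of the space of slices
by dim H_T'. -/
theorem range_matrixUnit_le (T : Finset ι) [FiniteDimensional ℂ (SubTensor H Tᶜ)]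
    (e₀ : SubTensor H T) : (matrixUnit (ampliateHom H T) e₀ e₀).range
      ≤ (ContinuousLinearMap.adjoint (split T) ∘L tmulL e₀).range := by
  refine range_le_of_regroup (T := T) fun a b => ?_
  rw [matrixUnit_regroup]
  exact Submodule.smul_mem _ _ (LinearMap.mem_range_self _ b)

theorem finiteDimensional_range_matrixUnit (T : Finset ι)
    [FiniteDimensional ℂ (SubTensor H Tᶜ)] (e₀ : SubTensor H T) :
    FiniteDimensional ℂ (matrixUnit (ampliateHom H T) e₀ e₀).range :=
  Submodule.finiteDimensional_of_le (range_matrixUnit_le T e₀)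

theorem finrank_range_matrixUnit_le (T : Finset ι) [FiniteDimensional ℂ (SubTensor H Tᶜ)]
    (e₀ : SubTensor H T) : Module.finrank ℂ (matrixUnit (ampliateHom H T) e₀ e₀).range
      ≤ Module.finrank ℂ (SubTensor H Tᶜ) :=
  (Submodule.finrank_mono (range_matrixUnit_le T e₀)).trans (LinearMap.finrank_range_le _)

theorem sphere_subset_closure_hyperentangledStates [∀ i, TopologicalSpace.SeparableSpace (H i)]
    {e₀ : Π T : Finset ι, SubTensor H T} (he₀ : ∀ T, ‖e₀ T‖ = 1)
    (h : ∀ T : Finset ι, T.Nonempty → Tᶜ.Nonempty → ∀ (v y : HTensor H) (δ : ℝ), 0 < δ →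
      (∃ e, ‖e‖ = 1 ∧ ‖slice (ampliateHom H T) (e₀ T) v e‖ < δ) ∨
        ∃ e, slice (ampliateHom H T) (e₀ T) v e
          = matrixUnit (ampliateHom H T) (e₀ T) (e₀ T) y) :
    Metric.sphere (0 : HTensor H) 1 ⊆ closure (hyperentangledStates H) := by
  obtain ⟨D, hDc, hD⟩ := TopologicalSpace.exists_countable_dense (HTensor H)
  have := hDc.to_subtype
  -- Targets from a countable dense set and tolerances 1 / (m + 1) make the family countable without
  -- weakening its intersection.
  let O : ({T : Finset ι // T.Nonempty ∧ Tᶜ.Nonempty} × D × ℕ) → Set (HTensor H) := fun q =>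
    {v | ∃ e, ‖slice (ampliateHom H q.1.1) (e₀ q.1.1) v e
      - matrixUnit (ampliateHom H q.1.1) (e₀ q.1.1) (e₀ q.1.1) q.2.1‖ < 1 / ((q.2.2 : ℝ) + 1)}
  have hdense : Dense (⋂ q, O q) := by
    refine dense_iInter_of_isOpen (fun q => isOpen_setOf_exists_slice _ _ _) fun q => ?_
    exact dense_setOf_exists_slice (he₀ _)
      (fun v δ hδ => h q.1.1 q.1.2.1 q.1.2.2 v q.2.1 δ hδ) (by positivity)
  have hslices : ∀ v ∈ ⋂ q, O q, ∀ T : Finset ι, T.Nonempty → Tᶜ.Nonempty →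
      DenseSlices (ampliateHom H T) (e₀ T) v := by
    intro v hv T hT hT' y δ hδ
    set M := matrixUnit (ampliateHom H T) (e₀ T) (e₀ T)
    have hc : Continuous fun z => ‖M z - M y‖ := (M.continuous.sub continuous_const).norm
    obtain ⟨d, hd, hdD⟩ := hD.inter_open_nonempty {z | ‖M z - M y‖ < δ / 2}
      (isOpen_lt hc continuous_const) ⟨y, by simpa using hδ⟩
    obtain ⟨m, hm⟩ := exists_nat_one_div_lt (half_pos hδ)
    obtain ⟨e, he⟩ := Set.mem_iInter.1 hv (⟨T, hT, hT'⟩, ⟨d, hdD⟩, m)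
    refine ⟨e, ?_⟩
    have h1 : ‖slice (ampliateHom H T) (e₀ T) v e - M d‖ < δ / 2 := he.trans hm
    have h2 : ‖M d - M y‖ < δ / 2 := hd
    have h3 := norm_add_le (slice (ampliateHom H T) (e₀ T) v e - M d) (M d - M y)
    rw [sub_add_sub_cancel] at h3
    linarith
  have hmem : ∀ v ∈ ⋂ q, O q, v ≠ 0 → ((‖v‖⁻¹ : ℝ) : ℂ) • v ∈ hyperentangledStates H := by
    intro v hv hv0
    have hn : ‖v‖ ≠ 0 := norm_ne_zero_iff.2 hv0
    refine ⟨?_, fun S T hS hT hST => ?_⟩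
    · rw [norm_smul, Complex.norm_real, norm_inv, norm_norm, inv_mul_cancel₀ hn]
    · have hT' : Tᶜ.Nonempty := by
        obtain ⟨i, hi⟩ := hS
        exact ⟨i, Finset.mem_compl.2 (Finset.disjoint_left.1 hST hi)⟩
      have hc : ((‖v‖⁻¹ : ℝ) : ℂ) ≠ 0 := by
        simpa using hv0
      rw [localAlgebra_eq_range T]
      refine ((hslices v hv T hT hT').smul hc).maximallyCorrelated (he₀ T)
        (eq_zero_of_slice_eq_zero T (he₀ T)) ?_
      rintro _ ⟨A, rfl⟩ B
      exact commute_ampliate hST A B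
  intro v hv
  have hv1 : ‖v‖ = 1 := by simpa using hv
  have hv0 : v ≠ 0 := by
    rintro rfl
    simp at hv1
  -- The Baire set is dense in the whole space, not yet in the sphere. Normalization is continuous
  -- at the unit vector `v` and fixes it, so it carries nearby generic vectors to nearby
  -- hyperentangled states.
  have hcont : ContinuousAt (fun w : HTensor H => ((‖w‖⁻¹ : ℝ) : ℂ) • w) v :=
    (Complex.continuous_ofReal.continuousAt.comp
      (continuous_norm.continuousAt.inv₀ (norm_ne_zero_iff.2 hv0))).smul continuousAt_id
  have hcl : v ∈ closure ((⋂ q, O q) ∩ {w | w ≠ 0}) :=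
    Set.inter_comm _ _ ▸ hdense.open_subset_closure_inter (isOpen_ne (x := (0 : HTensor H))) hv0
  have h1 := mem_closure_image hcont hcl
  have h2 : ((‖v‖⁻¹ : ℝ) : ℂ) • v = v := by rw [hv1]; simp
  rw [h2] at h1
  refine closure_mono ?_ h1
  rintro _ ⟨w, ⟨hw, hw0⟩, rfl⟩
  exact hmem w hw hw0

end Generic

/-! ### Dimension bounds forced by a hyperentangled state -/

section Obstruction

variable {ι : Type v} [Fintype ι] [DecidableEq ι] {H : ι → Type u}
  [∀ i, NormedAddCommGroup (H i)] [∀ i, InnerProductSpace ℂ (H i)]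
  {x : Π i, H i} (hx : ∀ i, ‖x i‖ = 1) {v : HTensor H} (hv : v ∈ hyperentangledStates H)

include hx hv

theorem card_le_finrank_subTensor {S T : Finset ι} (hS : S.Nonempty) (hT : T.Nonempty)
    (hST : Disjoint S T) [FiniteDimensional ℂ (SubTensor H T)] {k : ℕ}
    {y : Fin k → SubTensor H S} (hy : Orthonormal ℂ y) :
    k ≤ Module.finrank ℂ (SubTensor H T) := by
  have hu : ∀ R : Finset ι, ‖(htprod (restr R x) : SubTensor H R)‖ = 1 := fun R =>
    norm_htprod_eq_one fun i => hx i
  refine card_le_finrank_of_maximallyCorrelated (φ := ampliateHom H T)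
    (p := fun j => matrixUnit (ampliateHom H S) (y j) (y j)) (hu T) ?_ (hv.2 S T hS hT hST)
    (fun j => ⟨_, rfl⟩)
    (fun j => (InnerProductSpace.isStarProjection_rankOne_self (hy.1 j)).map _) ?_ ?_
  · rintro _ ⟨A, rfl⟩ B
    exact commute_ampliate hST A B
  -- |y j⟩⟨y j| ⊗ I is nonzero because it fixes a unit vector of the form y j ⊗ x.
  · intro j h0
    have h1 := matrixUnit_regroup S (y j) (y j) (y j) (htprod (restr Sᶜ x))
    have h2 := inner_regroup S (y j) (y j) (htprod (restr Sᶜ x)) (htprod (restr Sᶜ x))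
    rw [h0, inner_self_eq_norm_sq_to_K, hy.1] at h1
    rw [inner_self_eq_norm_sq_to_K, inner_self_eq_norm_sq_to_K (htprod _),
      inner_self_eq_norm_sq_to_K (y j), hu, hy.1] at h2
    simp at h1
    rw [← h1] at h2
    simp at h2
  · intro i j hij
    rw [matrixUnit_mul, hy.2 hij, zero_smul]

theorem card_le_finrank_factor {i j : ι} (hij : i ≠ j) [FiniteDimensional ℂ (H i)] {k : ℕ}
    {y : Fin k → H j} (hy : Orthonormal ℂ y) : k ≤ Module.finrank ℂ (H i) := by
  obtain ⟨h1, h2⟩ := finrank_subTensor_singleton hx i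
  rw [← h2]
  have hx' : ∀ l : ({j} : Finset ι), ‖restr {j} x l‖ = 1 := fun l => hx l
  exact card_le_finrank_subTensor hx hv (Finset.singleton_nonempty j) (Finset.singleton_nonempty i)
    (Finset.disjoint_singleton.2 hij.symm)
    (hy.comp_linearIsometry (insertAt hx' ⟨j, Finset.mem_singleton_self j⟩))

theorem finiteDimensional_factor [∀ i, CompleteSpace (H i)] {i j : ι} (hij : i ≠ j)
    [FiniteDimensional ℂ (H i)] : FiniteDimensional ℂ (H j) := by
  by_contra h
  obtain ⟨y, hy⟩ := exists_orthonormal_nat h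
  have := card_le_finrank_factor hx hv hij (k := Module.finrank ℂ (H i) + 1)
    (hy.comp _ Fin.val_injective)
  omega

theorem finrank_factor_le {i j : ι} (hij : i ≠ j) [FiniteDimensional ℂ (H i)]
    [FiniteDimensional ℂ (H j)] : Module.finrank ℂ (H j) ≤ Module.finrank ℂ (H i) :=
  card_le_finrank_factor hx hv hij (stdOrthonormalBasis ℂ (H j)).orthonormal

/-- A finite-dimensional factor bounds the dimension of every other one, so either all factors are
finite-dimensional, with mutual bounds, or all are infinite-dimensional, where separability forces
ℵ₀. -/
theorem hilbertDim_factor_eq [∀ i, CompleteSpace (H i)]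
    [∀ i, TopologicalSpace.SeparableSpace (H i)] (i j : ι) :
    hilbertDim (H i) = hilbertDim (H j) := by
  rcases eq_or_ne i j with rfl | hij
  · rfl
  by_cases h : FiniteDimensional ℂ (H i)
  · have := finiteDimensional_factor hx hv hij
    rw [hilbertDim_eq_finrank, hilbertDim_eq_finrank]
    exact congrArg _ (le_antisymm (finrank_factor_le hx hv hij.symm) (finrank_factor_le hx hv hij))
  · have h' : ¬ FiniteDimensional ℂ (H j) := fun h' => h (finiteDimensional_factor hx hv hij.symm)
    rw [hilbertDim_eq_aleph0 h, hilbertDim_eq_aleph0 h']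

/-- The subsystem {j, k} is correlated with {i}, and products of orthonormal bases of the two
factors are orthonormal in it. -/
theorem finrank_mul_finrank_le {i j k : ι} (hij : i ≠ j) (hik : i ≠ k) (hjk : j ≠ k)
    [FiniteDimensional ℂ (H i)] [FiniteDimensional ℂ (H j)] [FiniteDimensional ℂ (H k)] :
    Module.finrank ℂ (H j) * Module.finrank ℂ (H k) ≤ Module.finrank ℂ (H i) := by
  obtain ⟨h1, h2⟩ := finrank_subTensor_singleton hx i
  rw [← h2]
  let S : Finset ι := {j, k}
  let j' : S := ⟨j, by simp [S]⟩
  let k' : S := ⟨k, by simp [S]⟩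
  have hjk' : j' ≠ k' := fun h => hjk (congrArg Subtype.val h)
  have hx' : ∀ l : S, ‖restr S x l‖ = 1 := fun l => hx l
  let a := stdOrthonormalBasis ℂ (H j)
  let b := stdOrthonormalBasis ℂ (H k)
  let y : Fin (Module.finrank ℂ (H j)) × Fin (Module.finrank ℂ (H k)) → SubTensor H S := fun q =>
    htprod (Function.update (Function.update (restr S x) j' (a q.1)) k' (b q.2))
  have hy : Orthonormal ℂ y := by
    rw [orthonormal_iff_ite]
    intro p q
    refine (inner_htprod_update_update hx' hjk' _ _ _ _).trans ?_
    refine (congrArg₂ (· * ·) (orthonormal_iff_ite.1 a.orthonormal p.1 q.1)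
      (orthonormal_iff_ite.1 b.orthonormal p.2 q.2)).trans ?_
    simp only [Prod.ext_iff, ite_and]
    split_ifs <;> simp
  refine card_le_finrank_subTensor hx hv (S := S) ⟨j, by simp [S]⟩ (Finset.singleton_nonempty i)
    ?_ (hy.comp _ finProdFinEquiv.symm.injective)
  simp [S, hij, hik]

end Obstruction

end HilbertTensor

end

/-! ### The equivalence -/

theorem theorem4 {n : ℕ} (hn : 1 < n) (H : Fin n → Type*)
    [∀ i, NormedAddCommGroup (H i)] [∀ i, InnerProductSpace ℂ (H i)]
    [∀ i, CompleteSpace (H i)] [∀ i, TopologicalSpace.SeparableSpace (H i)]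
    (hdim : ∀ i, 1 < HilbertTensor.hilbertDim (H i)) :
    List.TFAE [
      (HilbertTensor.hyperentangledStates H).Nonempty,
      (∀ i j, HilbertTensor.hilbertDim (H i) = HilbertTensor.hilbertDim (H j)) ∧
        (2 < n → ∀ i, Cardinal.aleph0 ≤ HilbertTensor.hilbertDim (H i)),
      Metric.sphere (0 : HilbertTensor.HTensor H) 1 ⊆
        closure (HilbertTensor.hyperentangledStates H)] := by
  open HilbertTensor in
  choose x hx using fun i => exists_norm_eq_one_of_hilbertDim (hdim i)
  tfae_have 1 → 2 := by
    rintro ⟨v, hv⟩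
    refine ⟨hilbertDim_factor_eq hx hv, fun hn2 i => ?_⟩
    by_contra! hi
    have hfin : ∀ l, FiniteDimensional ℂ (H l) := fun l =>
      finiteDimensional_iff_hilbertDim_lt.2 (hilbertDim_factor_eq hx hv l i ▸ hi)
    obtain ⟨j, k, hij, hik, hjk⟩ : ∃ j k : Fin n, i ≠ j ∧ i ≠ k ∧ j ≠ k := by
      have hc : 2 < (Finset.univ : Finset (Fin n)).card := by simpa using hn2
      have h1 : 1 < (Finset.univ.erase i).card := by
        rw [Finset.card_erase_of_mem (Finset.mem_univ i)]
        omega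
      obtain ⟨j, hj, k, hk, hjk⟩ := Finset.one_lt_card.1 h1
      exact ⟨j, k, (Finset.ne_of_mem_erase hj).symm, (Finset.ne_of_mem_erase hk).symm, hjk⟩
    have h1 := finrank_mul_finrank_le hx hv hij hik hjk
    have h2 := finrank_factor_le hx hv hij.symm
    have h3 : 1 < Module.finrank ℂ (H k) := by
      have := hdim k
      rw [hilbertDim_eq_finrank] at this
      exact_mod_cast this
    have h4 : 1 < Module.finrank ℂ (H j) := by
      have := hdim j
      rw [hilbertDim_eq_finrank] at this
      exact_mod_cast this
    -- dim H_j · dim H_k ≤ dim H_i ≤ dim H_j is impossible, as dim H_k > 1 and dim H_j > 0.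
    nlinarith
  tfae_have 2 → 3 := by
    rintro ⟨heq, hinf⟩
    have hx' : ∀ (T : Finset (Fin n)) (i : T), ‖restr T x i‖ = 1 := fun T i => hx i
    refine sphere_subset_closure_hyperentangledStates
      (e₀ := fun T => htprod (restr T x)) (fun T => norm_htprod_eq_one (hx' T)) ?_
    intro T ⟨i, hi⟩ ⟨j, hj⟩ v y δ hδ
    by_cases hfin : FiniteDimensional ℂ (H i)
    -- A finite-dimensional factor forces n = 2, so T = {i} and its complement is {j}, of the same
    -- finite dimension.
    · have hn2 : ¬ 2 < n := fun h =>
        not_lt.2 (hinf h i) (finiteDimensional_iff_hilbertDim_lt.1 hfin)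
      have hjT : j ∉ T := Finset.mem_compl.1 hj
      have hij : i ≠ j := fun h => hjT (h ▸ hi)
      have hfinj : FiniteDimensional ℂ (H j) :=
        finiteDimensional_iff_hilbertDim_lt.2 (heq i j ▸ finiteDimensional_iff_hilbertDim_lt.1 hfin)
      have hT : ∀ l : T, l = ⟨i, hi⟩ := by
        intro l
        have hl : (l : Fin n) ≠ j := fun h => hjT (h ▸ l.2)
        ext
        simp only
        omega
      have hT' : ∀ l : (Tᶜ : Finset (Fin n)), l = ⟨j, hj⟩ := by
        intro l
        have hl : (l : Fin n) ≠ i := fun h => Finset.mem_compl.1 l.2 (h ▸ hi)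
        ext
        simp only
        omega
      have : FiniteDimensional ℂ (H (⟨i, hi⟩ : T)) := hfin
      have : FiniteDimensional ℂ (H (⟨j, hj⟩ : (Tᶜ : Finset (Fin n)))) := hfinj
      have hTf : FiniteDimensional ℂ (SubTensor H T) := finiteDimensional_of_forall_eq (hx' T) hT
      have hTf' : FiniteDimensional ℂ (SubTensor H Tᶜ) :=
        finiteDimensional_of_forall_eq (hx' Tᶜ) hT'
      have hrank : Module.finrank ℂ (SubTensor H Tᶜ) = Module.finrank ℂ (SubTensor H T) := by
        refine (finrank_eq_of_forall_eq (hx' Tᶜ) hT').trans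
          (Eq.trans ?_ (finrank_eq_of_forall_eq (hx' T) hT).symm)
        have h := heq j i
        rw [hilbertDim_eq_finrank, hilbertDim_eq_finrank] at h
        exact_mod_cast h
      have := finiteDimensional_range_matrixUnit T (htprod (restr T x))
      refine (exists_slice_eq_zero_or_eq (norm_htprod_eq_one (hx' T))
        ((finrank_range_matrixUnit_le T _).trans hrank.le) v y).imp_left ?_
      rintro ⟨e, he, he0⟩
      exact ⟨e, he, by rwa [he0, norm_zero]⟩
    -- One infinite-dimensional factor inside T already supplies an orthonormal sequence in H_T.
    · obtain ⟨z, hz⟩ := exists_orthonormal_nat hfin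
      exact Or.inl (exists_norm_slice_lt (hz.comp_linearIsometry (insertAt (hx' T) ⟨i, hi⟩))
        (norm_htprod_eq_one (hx' T)) v hδ)
  tfae_have 3 → 1 := by
    intro h
    have h1 : htprod x ∈ Metric.sphere (0 : HTensor H) 1 := by
      simpa using norm_htprod_eq_one hx
    exact closure_nonempty_iff.1 ⟨_, h h1⟩
  tfae_finish
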